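/- **Setting.** Let $\Sigma=\{1,\dots,d\}$, $T>0$, $0<\kappa\le M$, $A=[\kappa,M]^d$, and let $P(\Sigma)=\{m\in\mathbb R^d: m_j\ge 0,\ \sum_j m_j=1\}$; $|\cdot|$ is the Euclidean norm. Let $L:\Sigma\times A\to\mathbb R$ be continuous in its second argument, let $F,G:\Sigma\times P(\Sigma)\to\mathbb R$, and set $H(x,p)=\sup_{a\in A}\{-a\cdot p-L(x,a)\}$ for $x\in\Sigma$, $p\in\mathbb R^d$. Assume that for all $(x,p)$ this supremum has a unique maximizer $\alpha^*(x,p)\in A$. For $g:\Sigma\to\mathbb R$ write $\Delta g(x)=(g(y)-g(x))_{y\in\Sigma}\in\mathbb R^d$; for $g:\Sigma^N\to\mathbb R$ let $\Delta^j g(\boldsymbol x)\in\mathbb R^d$ be the same difference in the $j$-th coordinate; $\Delta^xU$ is the difference of $U(t,\cdot,m)$. A function $f$ on $P(\Sigma)$ has derivative $D^mf:P(\Sigma)\times\Sigma\to\mathbb R^d$ if $[D^mf(m,y)]_z=\lim_{s\to0^+}\frac{f(m+s(\delta_z-\delta_y))-f(m)}{s}$, the limit being taken only across those $s>0$ for which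 $m+s(\delta_z-\delta_y)\in P(\Sigma)$ (where there are none, no condition is imposed); $f$ is $C^1$ if $D^mf$ is continuous in $m$ on $P(\Sigma)$. The *Master Equation* for $U:[0,T]\times\Sigma\times P(\Sigma)\to\mathbb R$ is $$-\partial_tU+H(x,\Delta^xU)-\sum_{y\in\Sigma}D^mU(t,x,m,y)\cdot\alpha^*(y,\Delta^yU(t,y,m))\,m(y)=F(x,m),\qquad U(T,x,m)=G(x,m).$$ A *classical solution* is a $U$ that is jointly continuous, $C^1$ in $t$ on $[0,T]$, $C^1$ in $m$, and satisfies this on all of $[0,T]\times\Sigma\times P(\Sigma)$; it is *regular* if moreover $D^mU(t,x,\cdot)$ is Lipschitz continuous in $m$, uniformly in $(t,x)$. For $N\ge2$ and $\boldsymbol x\in\Sigma^N$ let $m^N_{\boldsymbol x}=\frac1N\sum_j\delta_{x_j}$ and $m^{N,i}_{\boldsymbol x}=\frac1{N-1}\sum_{j\ne i}\delta_{x_j}$. The value functions $v^{N,i}:[0,T]\times\Sigma^N\to\mathbb R$, $i=1,\dots,N$, of the $N$-player game are the classical solution of $$-\partial_tv^{N,i}-\sum_{j\neq i}\alpha^*(x_j,\Delta^jv^{N,j})\cdot\Delta^jv^{N,i}+H(x_i,\Delta^iv^{N,i})=F(x_i,m^{N,i}_{\boldsymbol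 x}),\qquad v^{N,i}(T,\boldsymbol x)=G(x_i,m^{N,i}_{\boldsymbol x}).\tag{HJB}$$ **Theorem 3.1.** Assume * **(H1)** for all $x\in\Sigma$, $H(x,\cdot)$ and $\alpha^*(x,\cdot)$ are Lipschitz continuous on $\{|p|\le K\}$, where $K$ is a fixed constant that is large enough, namely $K\ge2\sqrt d\,\bigl(\|G\|_\infty+T(\|L\|_\infty+\|F\|_\infty)\bigr)$ (sup norms over $\Sigma\times P(\Sigma)$ for $F$ and $G$, over $\Sigma\times A$ for $L$), and that the Master Equation has a regular solution $U$. Then there is a constant $C$ such that for all $N\ge2$, every solution $(v^{N,i})_{i\le N}$ of (HJB), all $t_0\in[0,T]$, $\boldsymbol x\in\Sigma^N$, $m_0\in P(\Sigma)$ and $i\in\{1,\dots,N\}$, $$\frac1N\sum_{k=1}^N\bigl|v^{N,k}(t_0,\boldsymbol x)-U(t_0,x_k,m^N_{\boldsymbol x})\bigr|\le\frac CN,$$ $$\|w^{N,i}(t_0,\cdot,m_0)-U(t_0,\cdot,m_0)\|_{L^1(m_0)}:=\sum_{x\in\Sigma}|w^{N,i}(t_0,x,m_0)-U(t_0,x,m_0)|\,m_0(x)\le\frac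 C{\sqrt N},$$ where $w^{N,i}(t_0,x,m_0)=\sum_{\boldsymbol x\in\Sigma^N:\ x_i=x}v^{N,i}(t_0,\boldsymbol x)\prod_{j\ne i}m_0(x_j)$. -/

import Mathlib

open Filter Topology Set
open scoped NNReal

noncomputable section

namespace FiniteMFG

/-- Vectors of `ℝ^d` with the Euclidean norm, indexed by the finite state space `Fin d`. -/
abbrev Vec (d : ℕ) : Type := EuclideanSpace ℝ (Fin d)

/-- The space of probability measures on the state space, as a simplex of `ℝ^d`. -/
def simplex (d : ℕ) : Set (Vec d) := {m | (∀ j, 0 ≤ m j) ∧ ∑ j, m j = 1}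

/-- The Dirac mass at the state `x`. -/
def dirac {d : ℕ} (x : Fin d) : Vec d := EuclideanSpace.single x 1

/-- The finite difference `Δ g (x) = (g y - g x)_y`. -/
def diff {d : ℕ} (g : Fin d → ℝ) (x : Fin d) : Vec d := WithLp.toLp 2 fun y => g y - g x

/-- The finite difference `Δ^j g (x)` with respect to the `j`-th coordinate. -/
def diffAt {d N : ℕ} (j : Fin N) (g : (Fin N → Fin d) → ℝ) (x : Fin N → Fin d) : Vec d :=
  WithLp.toLp 2 fun y => g (Function.update x j y) - g x

/-- The empirical measure of all the players. -/
def empirical {d N : ℕ} (x : Fin N → Fin d) : Vec d := (N : ℝ)⁻¹ • ∑ j, dirac (x j)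

/-- The empirical measure of all the players except the `i`-th (meaningful for `2 ≤ N`). -/
def empiricalExcept {d N : ℕ} (i : Fin N) (x : Fin N → Fin d) : Vec d :=
  ((N : ℝ) - 1)⁻¹ • ∑ j ∈ Finset.univ.erase i, dirac (x j)

/-- The set of control values `[κ, M]^d`. -/
def controlSet (d : ℕ) (κ M : ℝ) : Set (Vec d) := {a | ∀ y, a y ∈ Icc κ M}

/-- `a` maximizes `- a · p - ℓ(a)` over the control values. -/
def IsMaximizer {d : ℕ} (κ M : ℝ) (ℓ : Vec d → ℝ) (p a : Vec d) : Prop :=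
  a ∈ controlSet d κ M ∧ IsMaxOn (fun b => - inner ℝ b p - ℓ b) (controlSet d κ M) a

/-- The data of the game, with the standing assumptions: the Lagrangian is continuous in the
control, and the maximizer in the definition of the Hamiltonian is unique. Only the values of `L`
on the control set and of `F`, `G` on the simplex are ever used. -/
structure Game (d : ℕ) where
  T : ℝ
  κ : ℝ
  M : ℝ
  L : Fin d → Vec d → ℝ
  F : Fin d → Vec d → ℝ
  G : Fin d → Vec d → ℝ
  T_pos : 0 < T
  κ_pos : 0 < κ
  κ_le_M : κ ≤ M
  L_cont : ∀ x, ContinuousOn (L x) (controlSet d κ M)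
  unique_maximizer : ∀ x p, ∃! a, IsMaximizer κ M (L x) p a

/-- `D` is the derivative of `f` on the simplex: `D m y z` is the right derivative of `f` at `m`
in the direction `δ_z - δ_y`, the limit being taken only across those `s > 0` for which
`m + s (δ_z - δ_y)` stays in the simplex (there are none if `m y = 0` and `z ≠ y`, and there the
value of a continuous `D` is the limit of its values at the admissible points). -/
def IsSimplexDeriv {d : ℕ} (f : Vec d → ℝ) (D : Vec d → Fin d → Vec d) : Prop :=
  ∀ m ∈ simplex d, ∀ y z : Fin d,
    Tendsto (fun s : ℝ => (f (m + s • (dirac z - dirac y)) - f m) / s)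
      (𝓝[{s : ℝ | 0 < s ∧ m + s • (dirac z - dirac y) ∈ simplex d}] 0) (𝓝 (D m y z))

namespace Game

variable {d : ℕ} (𝓖 : Game d)

/-- The set of control values of the game. -/
def A : Set (Vec d) := controlSet d 𝓖.κ 𝓖.M

/-- The Hamiltonian `H(x, p) = sup_{a ∈ A} (- a · p - L(x, a))`. -/
def H (x : Fin d) (p : Vec d) : ℝ := sSup ((fun a => - inner ℝ a p - 𝓖.L x a) '' 𝓖.A)

/-- The maximizer `α^*(x, p)` in the definition of the Hamiltonian. -/
def αStar (x : Fin d) (p : Vec d) : Vec d := (𝓖.unique_maximizer x p).choose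

/-- `H` and `α^*` are Lipschitz continuous in `p` for `|p| ≤ K`. -/
def H1 (K : ℝ) : Prop :=
  ∀ x, (∃ C : ℝ≥0, LipschitzOnWith C (𝓖.H x) (Metric.closedBall 0 K)) ∧
    (∃ C : ℝ≥0, LipschitzOnWith C (𝓖.αStar x) (Metric.closedBall 0 K))

/-- `K` is at least `2 √d (‖G‖ + T (‖L‖ + ‖F‖))`, with sup norms over the control set and over the
simplex: the a priori size of the finite differences of the value functions. -/
def LargeRadius (K : ℝ) : Prop :=
  ∀ x y z : Fin d, ∀ a ∈ 𝓖.A, ∀ m ∈ simplex d, ∀ m' ∈ simplex d,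
    2 * √(d : ℝ) * (|𝓖.G x m| + 𝓖.T * (|𝓖.L y a| + |𝓖.F z m'|)) ≤ K

/-- `v i t x` is a classical solution of the Hamilton-Jacobi-Bellman system of the `N`-player game
with the mean field costs `F (x_i, m_x^{N,i})` and `G (x_i, m_x^{N,i})`. -/
def IsHJBSolution {N : ℕ} (v : Fin N → ℝ → (Fin N → Fin d) → ℝ) : Prop :=
  (∀ i x, ∀ t ∈ Icc 0 𝓖.T, ∃ v' : ℝ,
    HasDerivWithinAt (fun s => v i s x) v' (Icc 0 𝓖.T) t ∧
    - v' - ∑ j ∈ Finset.univ.erase i,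
          inner ℝ (𝓖.αStar (x j) (diffAt j (v j t) x)) (diffAt j (v i t) x)
        + 𝓖.H (x i) (diffAt i (v i t) x)
      = 𝓖.F (x i) (empiricalExcept i x)) ∧
  ∀ i x, v i 𝓖.T x = 𝓖.G (x i) (empiricalExcept i x)

/-- `U` is a classical solution of the Master Equation, with time derivative `Ut` and with
derivative `D t x m y` with respect to the measure. -/
structure IsClassicalSolution (U Ut : ℝ → Fin d → Vec d → ℝ)
    (D : ℝ → Fin d → Vec d → Fin d → Vec d) : Prop where
  cont : ∀ x, ContinuousOn (fun q : ℝ × Vec d => U q.1 x q.2) (Icc 0 𝓖.T ×ˢ simplex d)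
  deriv_time : ∀ x, ∀ m ∈ simplex d, ∀ t ∈ Icc 0 𝓖.T,
    HasDerivWithinAt (fun s => U s x m) (Ut t x m) (Icc 0 𝓖.T) t
  cont_deriv_time : ∀ x, ∀ m ∈ simplex d, ContinuousOn (fun t => Ut t x m) (Icc 0 𝓖.T)
  deriv_measure : ∀ t ∈ Icc 0 𝓖.T, ∀ x, IsSimplexDeriv (U t x) (D t x)
  cont_deriv_measure : ∀ t ∈ Icc 0 𝓖.T, ∀ x y, ContinuousOn (fun m => D t x m y) (simplex d)
  equation : ∀ t ∈ Icc 0 𝓖.T, ∀ x, ∀ m ∈ simplex d,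
    - Ut t x m + 𝓖.H x (diff (fun z => U t z m) x)
        - ∑ y, inner ℝ (D t x m y) (𝓖.αStar y (diff (fun z => U t z m) y)) * m y
      = 𝓖.F x m
  terminal : ∀ x, ∀ m ∈ simplex d, U 𝓖.T x m = 𝓖.G x m

/-- `U` is a regular solution of the Master Equation: a classical solution whose derivative with
respect to the measure is Lipschitz continuous in the measure, uniformly in time and state. -/
def IsRegularSolution (U : ℝ → Fin d → Vec d → ℝ) : Prop :=
  ∃ Ut D, 𝓖.IsClassicalSolution U Ut D ∧
    ∃ C : ℝ≥0, ∀ t ∈ Icc 0 𝓖.T, ∀ x y, LipschitzOnWith C (fun m => D t x m y) (simplex d)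

end Game

/-- `w^{N,i}(t, x, m₀)`: the average of `v^{N,i}(t, ·)` over the states of the players other than
`i`, with respect to the product of copies of `m₀`, the state of player `i` being `x`. -/
def averaged {d N : ℕ} (v : Fin N → ℝ → (Fin N → Fin d) → ℝ) (i : Fin N) (t : ℝ) (x : Fin d)
    (m₀ : Vec d) : ℝ :=
  ∑ y : Fin N → Fin d with y i = x, v i t y * ∏ j ∈ Finset.univ.erase i, m₀ (y j)

/-- The norm of `L¹(m₀)`. -/
def normL1 {d : ℕ} (m₀ : Vec d) (g : Fin d → ℝ) : ℝ := ∑ x, |g x| * m₀ x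

end FiniteMFG

end

/-!
Evaluated at the empirical measures of the other players, `u^i(t, x) = U(t, x_i, m_x^{N,i})` solves
the Hamilton-Jacobi-Bellman system up to an error `O(1/N)`. Indeed a jump of player `j ≠ i` moves
`m_x^{N,i}` by `(δ_z - δ_{x_j}) / (N - 1)`, so a first-order Taylor expansion of `U` in the measure,
with remainder `O(1/N²)` because `D^m U` is Lipschitz, turns the sum over the `N - 1` other players
into the transport term of the Master Equation.

The generator of a Markov chain is nonpositive at a maximum and nonnegative at a minimum. By this
maximum principle the finite differences of `v^i` and of `U` stay in the ball on which the
Hamiltonian and the optimal controls are Lipschitz. Applied to `v^i - u^i`, whose coupling terms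
are at most linear in `max_j ‖v^j - u^j‖_∞` since `Δ^j u^i = O(1/N)` for `j ≠ i`, it yields a
Grönwall inequality, hence `v^i - u^i = O(1/N)` uniformly. The first estimate follows because
`m_x^{N,i}` is within `2/N` of `m_x^N`. The second follows because, when the other players are
independent with law `m₀`, the mean distance from `m_x^{N,i}` to `m₀` is `O(1/√N)`.
-/

namespace FiniteMFG

section MaximumPrinciple

variable {X : Type*} [TopologicalSpace X] {S : Set X} {a b B : ℝ} {f : ℝ → X → ℝ}

theorem le_of_deriv_pos_of_isMaxOn (hS : IsCompact S)
    (hc : ContinuousOn (fun q : ℝ × X => f q.1 q.2) (Icc a b ×ˢ S)) (hb : ∀ x ∈ S, f b x ≤ B)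
    (hmax : ∀ t ∈ Icc a b, ∀ x ∈ S, IsMaxOn (f t) S x → B < f t x →
      ∃ f', HasDerivWithinAt (f · x) f' (Icc a b) t ∧ 0 < f') :
    ∀ t ∈ Icc a b, ∀ x ∈ S, f t x ≤ B := by
  intro t ht x hx
  by_contra! hB
  obtain ⟨⟨τ, ξ⟩, ⟨hτ, hξ⟩, hm⟩ :=
    (isCompact_Icc.prod hS).exists_isMaxOn ⟨(t, x), ht, hx⟩ hc
  have hle : ∀ s ∈ Icc a b, ∀ y ∈ S, f s y ≤ f τ ξ := fun s hs y hy =>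
    hm (show (s, y) ∈ Icc a b ×ˢ S from ⟨hs, hy⟩)
  have hτB : B < f τ ξ := hB.trans_le (hle t ht x hx)
  have hτb : τ < b := lt_of_le_of_ne hτ.2 fun h => (hb ξ hξ).not_gt (h ▸ hτB)
  obtain ⟨f', hd, hpos⟩ := hmax τ hτ ξ hξ (fun y hy => hle τ hτ y hy) hτB
  have hloc : IsLocalMaxOn (f · ξ) (Icc a b) τ :=
    eventually_nhdsWithin_of_forall fun s hs => hle s hs ξ hξ
  have hcone : b - τ ∈ posTangentConeAt (Icc a b) τ := by
    refine sub_mem_posTangentConeAt_of_segment_subset ?_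
    rw [segment_eq_Icc hτb.le]
    exact Icc_subset_Icc_left hτ.1
  have hnonpos : (b - τ) * f' ≤ 0 := by
    simpa using hloc.hasFDerivWithinAt_nonpos hd.hasFDerivWithinAt hcone
  exact hnonpos.not_gt (mul_pos (sub_pos.2 hτb) hpos)

theorem le_of_deriv_nonneg_of_isMaxOn (hS : IsCompact S)
    (hc : ContinuousOn (fun q : ℝ × X => f q.1 q.2) (Icc a b ×ˢ S)) (hb : ∀ x ∈ S, f b x ≤ B)
    (hmax : ∀ t ∈ Icc a b, ∀ x ∈ S, IsMaxOn (f t) S x →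
      ∃ f', HasDerivWithinAt (f · x) f' (Icc a b) t ∧ 0 ≤ f') :
    ∀ t ∈ Icc a b, ∀ x ∈ S, f t x ≤ B := by
  have hperturbed : ∀ η > 0, ∀ t ∈ Icc a b, ∀ x ∈ S, f t x - η * (b - t) ≤ B := by
    intro η hη
    refine le_of_deriv_pos_of_isMaxOn (f := fun s y => f s y - η * (b - s)) hS
      (hc.sub (by fun_prop)) (by simpa using hb) fun t ht x hx hx_max _ => ?_
    obtain ⟨f', hd, hf'⟩ := hmax t ht x hx fun y hy => by simpa using hx_max hy
    exact ⟨f' - η * (-1), hd.sub (((hasDerivAt_id t).const_sub b).const_mul η).hasDerivWithinAt,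
      by linarith⟩
  intro t ht x hx
  have hlim : Tendsto (fun η => f t x - η * (b - t)) (𝓝[>] 0) (𝓝 (f t x)) := by
    refine tendsto_nhdsWithin_of_tendsto_nhds (Continuous.tendsto' ?_ _ _ (by simp))
    fun_prop
  exact le_of_tendsto hlim (eventually_nhdsWithin_of_forall fun η hη => hperturbed η hη t ht x hx)

theorem le_gronwallBound_of_isMaxOn (hS : IsCompact S) {δ K ε : ℝ}
    (hc : ContinuousOn (fun q : ℝ × X => f q.1 q.2) (Icc a b ×ˢ S)) (hb : ∀ x ∈ S, f b x ≤ δ)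
    (hmax : ∀ t ∈ Icc a b, ∀ x ∈ S, IsMaxOn (f t) S x →
      ∃ f', HasDerivWithinAt (f · x) f' (Icc a b) t ∧ -f' ≤ K * f t x + ε) :
    ∀ t ∈ Icc a b, ∀ x ∈ S, f t x ≤ gronwallBound δ K ε (b - t) := by
  have hbound : ∀ t, HasDerivAt (fun s => gronwallBound δ K ε (b - s))
      ((K * gronwallBound δ K ε (b - t) + ε) * -1) t := fun t =>
    (hasDerivAt_gronwallBound δ K ε (b - t)).comp t ((hasDerivAt_id t).const_sub b)
  have hexp : ∀ t, HasDerivAt (fun s => Real.exp (K * (s - b)))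
      (Real.exp (K * (t - b)) * (K * 1)) t := fun t =>
    (((hasDerivAt_id t).sub_const b).const_mul K).exp
  have hscaled : ∀ t ∈ Icc a b, ∀ x ∈ S,
      Real.exp (K * (t - b)) * (f t x - gronwallBound δ K ε (b - t)) ≤ 0 := by
    have hcont : Continuous fun s => gronwallBound δ K ε (b - s) :=
      continuous_iff_continuousAt.2 fun t => (hbound t).continuousAt
    refine le_of_deriv_nonneg_of_isMaxOn hS
      (.mul (by fun_prop) (hc.sub (hcont.comp continuous_fst).continuousOn))
      (fun x hx => by simpa [gronwallBound_x0] using hb x hx) fun t ht x hx hx_max => ?_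
    have hpos := Real.exp_pos (K * (t - b))
    obtain ⟨f', hd, hf'⟩ := hmax t ht x hx fun y hy => by
      simpa using le_of_mul_le_mul_left (hx_max hy) hpos
    refine ⟨_, (hexp t).hasDerivWithinAt.mul (hd.sub (hbound t).hasDerivWithinAt), ?_⟩
    calc 0 ≤ Real.exp (K * (t - b)) * (K * f t x + ε + f') :=
          mul_nonneg hpos.le (by linarith)
      _ = _ := by ring
  intro t ht x hx
  exact sub_nonpos.1 (nonpos_of_mul_nonpos_right (hscaled t ht x hx) (Real.exp_pos _))

theorem abs_le_gronwallBound_of_drift (hS : IsCompact S) {δ K ε : ℝ} {β ℓ : ℝ → X → ℝ}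
    (hc : ContinuousOn (fun q : ℝ × X => f q.1 q.2) (Icc a b ×ˢ S))
    (hderiv : ∀ t ∈ Icc a b, ∀ x ∈ S,
      HasDerivWithinAt (f · x) (-(β t x + ℓ t x)) (Icc a b) t)
    (hmax : ∀ t ∈ Icc a b, ∀ x ∈ S, IsMaxOn (f t) S x → β t x ≤ 0)
    (hmin : ∀ t ∈ Icc a b, ∀ x ∈ S, IsMinOn (f t) S x → 0 ≤ β t x)
    (hℓ : ∀ t ∈ Icc a b, ∀ x ∈ S, ∀ ρ, (∀ y ∈ S, |f t y| ≤ ρ) → |ℓ t x| ≤ K * ρ + ε)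
    (hb : ∀ x ∈ S, |f b x| ≤ δ) :
    ∀ t ∈ Icc a b, ∀ x ∈ S, |f t x| ≤ gronwallBound δ K ε (b - t) := by
  -- Both bounds at once: the maximum principle is applied to `σ f` on `{1, -1} × S`.
  have hsigned : ∀ t ∈ Icc a b, ∀ q ∈ ({1, -1} : Set ℝ) ×ˢ S,
      q.1 * f t q.2 ≤ gronwallBound δ K ε (b - t) := by
    refine le_gronwallBound_of_isMaxOn (((finite_singleton _).insert _).isCompact.prod hS)
      (continuous_snd.fst.continuousOn.mul (hc.comp (f := fun q : ℝ × ℝ × X => (q.1, q.2.2))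
        (by fun_prop) fun q hq => ⟨hq.1, hq.2.2⟩)) ?_ ?_
    · rintro ⟨σ, x⟩ ⟨rfl | rfl, hx⟩ <;> simp only [one_mul, neg_one_mul]
      · exact (abs_le.1 (hb x hx)).2
      · linarith [(abs_le.1 (hb x hx)).1]
    · rintro t ht ⟨σ, x⟩ ⟨hσ, hx⟩ hx_max
      have habs : ∀ y ∈ S, |f t y| ≤ σ * f t x := fun y hy => abs_le'.2
        ⟨by simpa using hx_max (show (1, y) ∈ ({1, -1} : Set ℝ) ×ˢ S from ⟨by simp, hy⟩),
         by simpa using hx_max (show (-1, y) ∈ ({1, -1} : Set ℝ) ×ˢ S from ⟨by simp, hy⟩)⟩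
      have hσβ : σ * β t x ≤ 0 := by
        rcases hσ with rfl | rfl
        · rw [one_mul]
          exact hmax t ht x hx fun y hy => (le_abs_self _).trans (by simpa using habs y hy)
        · rw [neg_one_mul, neg_nonpos]
          exact hmin t ht x hx fun y hy => by
            simpa using (neg_le_abs (f t y)).trans (habs y hy)
      have hσℓ : σ * ℓ t x ≤ |ℓ t x| := by
        rcases hσ with rfl | rfl
        · simpa using le_abs_self _
        · simpa using neg_le_abs _
      refine ⟨_, (hderiv t ht x hx).const_mul σ, ?_⟩
      linarith [hℓ t ht x hx _ habs]
  exact fun t ht x hx => abs_le'.2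
    ⟨by simpa using hsigned t ht (1, x) ⟨by simp, hx⟩,
     by simpa using hsigned t ht (-1, x) ⟨by simp, hx⟩⟩

end MaximumPrinciple

variable {d : ℕ}

section Vectors

theorem norm_le_sqrt_mul {p : Vec d} {b : ℝ} (hb : 0 ≤ b) (h : ∀ y, |p y| ≤ b) :
    ‖p‖ ≤ √(d : ℝ) * b := by
  rw [EuclideanSpace.norm_eq, ← Real.sqrt_sq hb, ← Real.sqrt_mul (Nat.cast_nonneg d)]
  refine Real.sqrt_le_sqrt ?_
  calc ∑ y, ‖p y‖ ^ 2 ≤ ∑ _y : Fin d, b ^ 2 :=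
        Finset.sum_le_sum fun y _ => pow_le_pow_left₀ (norm_nonneg _) (h y) 2
    _ = d * b ^ 2 := by simp

theorem sum_abs_le_sqrt_mul_norm (p : Vec d) : ∑ y, |p y| ≤ √(d : ℝ) * ‖p‖ := by
  rw [EuclideanSpace.norm_eq, ← Real.sqrt_mul (Nat.cast_nonneg d)]
  refine Real.le_sqrt_of_sq_le ?_
  simpa using sq_sum_le_card_mul_sum_sq (s := Finset.univ) (f := fun y => |p y|)

theorem inner_nonneg_of_nonneg {a p : Vec d} (ha : ∀ y, 0 ≤ a y) (hp : ∀ y, 0 ≤ p y) :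
    0 ≤ inner ℝ a p := by
  rw [PiLp.inner_apply]
  exact Finset.sum_nonneg fun y _ => by simpa using mul_nonneg (hp y) (ha y)

theorem inner_nonpos_of_nonneg_of_nonpos {a p : Vec d} (ha : ∀ y, 0 ≤ a y)
    (hp : ∀ y, p y ≤ 0) : inner ℝ a p ≤ 0 := by
  rw [← neg_nonneg, ← inner_neg_right]
  exact inner_nonneg_of_nonneg ha fun y => by simpa using hp y

theorem abs_inner_sub_inner_le {E : Type*} [NormedAddCommGroup E] [InnerProductSpace ℝ E]
    (a b p q : E) : |inner ℝ a p - inner ℝ b q| ≤ ‖a - b‖ * ‖p‖ + ‖b‖ * ‖p - q‖ := by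
  have hsplit : inner ℝ a p - inner ℝ b q = inner ℝ (a - b) p + inner ℝ b (p - q) := by
    rw [inner_sub_left, inner_sub_right]
    ring
  rw [hsplit]
  exact (abs_add_le _ _).trans
    (add_le_add (abs_real_inner_le_norm _ _) (abs_real_inner_le_norm _ _))

end Vectors

section Simplex

variable {m : Vec d}

theorem convex_simplex : Convex ℝ (simplex d) :=
  (convex_stdSimplex ℝ (Fin d)).is_linear_preimage (WithLp.linearEquiv 2 ℝ _).toLinearMap.isLinear

theorem isCompact_simplex : IsCompact (simplex d) := by
  have himage : simplex d = WithLp.toLp 2 '' stdSimplex ℝ (Fin d) := by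
    ext m
    exact ⟨fun hm => ⟨_, hm, rfl⟩, by rintro ⟨p, hp, rfl⟩; exact hp⟩
  rw [himage]
  exact (isCompact_stdSimplex ℝ (Fin d)).image (PiLp.continuous_toLp 2 _)

theorem dirac_apply (x y : Fin d) : dirac x y = if y = x then 1 else 0 := by
  simp [dirac]

theorem dirac_mem_simplex (x : Fin d) : dirac x ∈ simplex d :=
  ⟨fun j => by rw [dirac_apply]; positivity, by simp [dirac_apply]⟩

theorem norm_le_one_of_mem_simplex (hm : m ∈ simplex d) : ‖m‖ ≤ 1 := by
  rw [EuclideanSpace.norm_eq, Real.sqrt_le_one, ← hm.2]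
  refine Finset.sum_le_sum fun j _ => ?_
  have hj : m j ≤ 1 := hm.2 ▸ Finset.single_le_sum (fun k _ => hm.1 k) (Finset.mem_univ j)
  rw [Real.norm_eq_abs, sq_abs, sq]
  exact mul_le_of_le_one_left (hm.1 j) hj

theorem norm_sub_le_two_of_mem_simplex {m' : Vec d} (hm : m ∈ simplex d) (hm' : m' ∈ simplex d) :
    ‖m - m'‖ ≤ 2 :=
  (norm_sub_le _ _).trans
    (by linarith [norm_le_one_of_mem_simplex hm, norm_le_one_of_mem_simplex hm'])

theorem norm_dirac_sub_dirac_le (z y : Fin d) : ‖dirac z - dirac y‖ ≤ 2 :=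
  norm_sub_le_two_of_mem_simplex (dirac_mem_simplex z) (dirac_mem_simplex y)

theorem norm_add_smul_dirac_sub_sub_le {E : Type*} [SeminormedAddCommGroup E] {g : Vec d → E}
    {C : ℝ≥0} (hg : LipschitzOnWith C g (simplex d)) {y z : Fin d} {h : ℝ} (h0 : 0 ≤ h)
    (hm : m ∈ simplex d) (hm' : m + h • (dirac z - dirac y) ∈ simplex d) :
    ‖g (m + h • (dirac z - dirac y)) - g m‖ ≤ 2 * C * h :=
  calc ‖g (m + h • (dirac z - dirac y)) - g m‖ ≤ C * ‖h • (dirac z - dirac y : Vec d)‖ := by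
        simpa using hg.norm_sub_le hm' hm
    _ ≤ C * (h * 2) := by
      rw [norm_smul, Real.norm_of_nonneg h0]
      gcongr
      exact norm_dirac_sub_dirac_le z y
    _ = 2 * C * h := by ring

theorem add_smul_mem_simplex_of_le {e : Vec d} {h s : ℝ} (hm : m ∈ simplex d)
    (hh : m + h • e ∈ simplex d) (hs : s ∈ Icc 0 h) : m + s • e ∈ simplex d := by
  rcases (hs.1.trans hs.2).eq_or_lt with rfl | h0
  · simpa [le_antisymm hs.2 hs.1] using hm
  · have := convex_simplex.add_smul_mem hm hh (t := s / h)
      ⟨div_nonneg hs.1 h0.le, (div_le_one h0).2 hs.2⟩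
    rwa [smul_smul, div_mul_cancel₀ _ h0.ne'] at this

theorem add_smul_dirac_sub_mem_simplex (hm : m ∈ simplex d) {y : Fin d} {h : ℝ}
    (hh : h ∈ Icc 0 (m y)) (z : Fin d) : m + h • (dirac z - dirac y) ∈ simplex d := by
  refine ⟨fun j => ?_, by simp [Finset.sum_add_distrib, ← Finset.mul_sum, hm.2,
    (dirac_mem_simplex _).2]⟩
  have hz : 0 ≤ h * dirac z j := mul_nonneg hh.1 ((dirac_mem_simplex z).1 j)
  simp only [PiLp.add_apply, PiLp.smul_apply, PiLp.sub_apply, smul_eq_mul, mul_sub]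
  rw [dirac_apply y j]
  split_ifs with hj
  · subst hj
    linarith [hh.2]
  · linarith [hm.1 j]

end Simplex

section Transport

theorem exists_coupling {ι : Type*} [Fintype ι] {a b : ι → ℝ} (ha : ∀ i, 0 ≤ a i)
    (hb : ∀ i, 0 ≤ b i) (hab : ∑ i, a i = ∑ i, b i) :
    ∃ π : ι × ι → ℝ, (∀ p, 0 ≤ π p) ∧ (∀ i, ∑ j, π (i, j) = a i) ∧ ∀ j, ∑ i, π (i, j) = b j := by
  refine ⟨fun p => a p.1 * b p.2 / ∑ i, a i, fun p => div_nonneg (mul_nonneg (ha _) (hb _))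
    (Finset.sum_nonneg fun i _ => ha i), fun i => ?_, fun j => ?_⟩
  · simp only
    rw [← Finset.sum_div, ← Finset.mul_sum, ← hab]
    exact mul_div_cancel_of_imp fun h0 =>
      (Finset.sum_eq_zero_iff_of_nonneg fun i _ => ha i).1 h0 i (Finset.mem_univ i)
  · simp only
    rw [← Finset.sum_div, ← Finset.sum_mul, mul_comm]
    exact mul_div_cancel_of_imp fun h0 =>
      (Finset.sum_eq_zero_iff_of_nonneg fun i _ => hb i).1 (hab ▸ h0) j (Finset.mem_univ j)

theorem sum_smul_dirac_sub_apply (π : Fin d × Fin d → ℝ) (j : Fin d) :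
    (∑ p, π p • (dirac p.2 - dirac p.1)) j = ∑ y, π (y, j) - ∑ z, π (j, z) := by
  simp [Fintype.sum_prod_type, dirac_apply, mul_sub, Finset.sum_sub_distrib]

theorem add_sum_smul_dirac_sub_mem_simplex {m : Vec d} (hm : m ∈ simplex d)
    {π : Fin d × Fin d → ℝ} (hπ : ∀ p, 0 ≤ π p) (hout : ∀ y, ∑ z, π (y, z) ≤ m y)
    (P : Finset (Fin d × Fin d)) : m + ∑ p ∈ P, π p • (dirac p.2 - dirac p.1) ∈ simplex d := by
  set π' : Fin d × Fin d → ℝ := fun p => if p ∈ P then π p else 0 with hπ'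
  have hπ'_nonneg : ∀ p, 0 ≤ π' p := fun p => by
    simp only [hπ']
    split_ifs
    exacts [hπ p, le_rfl]
  have hπ'_le : ∀ p, π' p ≤ π p := fun p => by
    simp only [hπ']
    split_ifs
    exacts [le_rfl, hπ p]
  have hrestrict : ∑ p ∈ P, π p • (dirac p.2 - dirac p.1) =
      ∑ p, π' p • (dirac p.2 - dirac p.1) := by
    simp [hπ', ite_smul, Finset.sum_ite_mem]
  rw [hrestrict]
  refine ⟨fun j => ?_, ?_⟩ <;> simp only [PiLp.add_apply, sum_smul_dirac_sub_apply]
  · have hin : 0 ≤ ∑ y, π' (y, j) := Finset.sum_nonneg fun y _ => hπ'_nonneg _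
    have hout' : ∑ z, π' (j, z) ≤ m j := (Finset.sum_le_sum fun z _ => hπ'_le _).trans (hout j)
    linarith
  · rw [Finset.sum_add_distrib, Finset.sum_sub_distrib, Finset.sum_comm, sub_self, add_zero, hm.2]

theorem exists_transport {m m₁ : Vec d} (hm : m ∈ simplex d) (hm₁ : m₁ ∈ simplex d) :
    ∃ π : Fin d × Fin d → ℝ, (∀ p, 0 ≤ π p) ∧ (∀ y, ∑ z, π (y, z) ≤ m y) ∧
      m + ∑ p, π p • (dirac p.2 - dirac p.1) = m₁ ∧ ∑ p, π p ≤ √(d : ℝ) * ‖m - m₁‖ := by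
  -- Only the excess `(m - m₁)⁺` is moved, onto the deficit `(m - m₁)⁻`.
  obtain ⟨π, hπ, hout, hin⟩ := exists_coupling (a := fun y => (m y - m₁ y)⁺)
    (b := fun y => (m y - m₁ y)⁻) (fun y => posPart_nonneg _) (fun y => negPart_nonneg _) (by
      rw [← sub_eq_zero, ← Finset.sum_sub_distrib]
      simp only [posPart_sub_negPart, Finset.sum_sub_distrib, hm.2, hm₁.2, sub_self])
  refine ⟨π, hπ, fun y => ?_, ?_, ?_⟩
  · rw [hout, posPart_def]
    exact sup_le (sub_le_self _ (hm₁.1 y)) (hm.1 y)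
  · ext j
    rw [PiLp.add_apply, sum_smul_dirac_sub_apply, hin, hout]
    linarith [posPart_sub_negPart (m j - m₁ j)]
  · rw [Fintype.sum_prod_type]
    simp only [hout]
    refine (Finset.sum_le_sum fun y _ => ?_).trans (sum_abs_le_sqrt_mul_norm (m - m₁))
    exact sup_le (le_abs_self _) (abs_nonneg _)

theorem lipschitzOnWith_of_abs_move_le {f : Vec d → ℝ} {R : ℝ≥0}
    (hf : ∀ m ∈ simplex d, ∀ (y z : Fin d) (h : ℝ), 0 ≤ h →
      m + h • (dirac z - dirac y) ∈ simplex d → |f (m + h • (dirac z - dirac y)) - f m| ≤ R * h) :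
    LipschitzOnWith (NNReal.sqrt d * R) f (simplex d) := by
  refine LipschitzOnWith.of_dist_le_mul fun m hm m' hm' => ?_
  obtain ⟨π, hπ, hout, rfl, hcost⟩ := exists_transport hm hm'
  have hmem := add_sum_smul_dirac_sub_mem_simplex hm hπ hout
  have hpath : ∀ P : Finset (Fin d × Fin d),
      |f (m + ∑ p ∈ P, π p • (dirac p.2 - dirac p.1)) - f m| ≤ R * ∑ p ∈ P, π p := fun P => by
    induction P using Finset.induction_on with
    | empty => simp
    | insert p P hp ih =>
      have hmove := hmem (insert p P)
      rw [Finset.sum_insert hp, add_comm (π p • _), ← add_assoc] at hmove ⊢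
      rw [Finset.sum_insert hp, mul_add]
      exact (abs_sub_le _ _ _).trans (add_le_add (hf _ (hmem P) _ _ _ (hπ p) hmove) ih)
  rw [dist_comm, Real.dist_eq, dist_eq_norm]
  calc _ ≤ R * ∑ p, π p := hpath Finset.univ
    _ ≤ R * (√d * ‖m - (m + ∑ p, π p • (dirac p.2 - dirac p.1))‖) := by gcongr
    _ = _ := by push_cast; ring

end Transport

section Derivative

variable {f : Vec d → ℝ} {D : Vec d → Fin d → Vec d} {m : Vec d} {C : ℝ≥0}

namespace IsSimplexDeriv

theorem neg (hf : IsSimplexDeriv f D) : IsSimplexDeriv (fun m => -f m) (fun m y => -D m y) := by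
  intro m hm y z
  refine (hf m hm y z).neg.congr fun s => ?_
  rw [← neg_div, neg_sub, neg_sub_neg]

theorem nonpos_of_isMaxOn (hf : IsSimplexDeriv f D) (hm : m ∈ simplex d)
    (hmax : IsMaxOn f (simplex d) m) {y : Fin d} (hy : 0 < m y) (z : Fin d) : D m y z ≤ 0 := by
  have hne : (𝓝[{s : ℝ | 0 < s ∧ m + s • (dirac z - dirac y) ∈ simplex d}] 0).NeBot := by
    refine (nhdsGT_neBot (0 : ℝ)).mono ?_
    rw [← nhdsWithin_Ioo_eq_nhdsGT hy]
    exact nhdsWithin_mono _ fun s hs =>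
      ⟨hs.1, add_smul_dirac_sub_mem_simplex hm (Ioo_subset_Icc_self hs) z⟩
  refine le_of_tendsto (hf m hm y z) (eventually_nhdsWithin_of_forall fun s hs => ?_)
  exact div_nonpos_of_nonpos_of_nonneg (sub_nonpos.2 (hmax hs.2)) hs.1.le

theorem hasDerivWithinAt_Ici (hf : IsSimplexDeriv f D) {y z : Fin d} {s h : ℝ} (hsh : s < h)
    (hs : m + s • (dirac z - dirac y) ∈ simplex d) (hh : m + h • (dirac z - dirac y) ∈ simplex d) :
    HasDerivWithinAt (fun r : ℝ => f (m + r • (dirac z - dirac y)))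
      (D (m + s • (dirac z - dirac y)) y z) (Ici s) s := by
  have hadd : ∀ r : ℝ, m + s • (dirac z - dirac y) + (r - s) • (dirac z - dirac y) =
      m + r • (dirac z - dirac y) := fun r => by
    rw [add_assoc, ← add_smul, add_sub_cancel]
  rw [← hasDerivWithinAt_Ioi_iff_Ici, hasDerivWithinAt_iff_tendsto_slope' self_notMem_Ioi]
  have hshift : Tendsto (fun r : ℝ => r - s) (𝓝[>] s) (𝓝[{r : ℝ | 0 < r ∧
      m + s • (dirac z - dirac y) + r • (dirac z - dirac y) ∈ simplex d}] 0) := by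
    refine tendsto_nhdsWithin_iff.2 ⟨tendsto_nhdsWithin_of_tendsto_nhds
      (Continuous.tendsto' (by fun_prop) _ _ (sub_self s)), ?_⟩
    filter_upwards [Ioo_mem_nhdsGT hsh] with r hr
    refine ⟨sub_pos.2 hr.1, add_smul_mem_simplex_of_le hs (h := h - s) ?_ ⟨?_, ?_⟩⟩
    · rwa [hadd]
    · exact sub_nonneg.2 hr.1.le
    · exact sub_le_sub_right hr.2.le s
  refine ((hf _ hs y z).comp hshift).congr fun r => ?_
  rw [Function.comp_apply, hadd, slope_def_field]

theorem abs_sub_sub_mul_le (hf : IsSimplexDeriv f D) (hc : ContinuousOn f (simplex d))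
    (hm : m ∈ simplex d) {y z : Fin d} {h : ℝ} (h0 : 0 ≤ h)
    (hh : m + h • (dirac z - dirac y) ∈ simplex d) {a ε : ℝ}
    (hD : ∀ s ∈ Icc 0 h, |D (m + s • (dirac z - dirac y)) y z - a| ≤ ε) :
    |f (m + h • (dirac z - dirac y)) - f m - h * a| ≤ ε * h := by
  have hmem : ∀ s ∈ Icc 0 h, m + s • (dirac z - dirac y) ∈ simplex d := fun s hs =>
    add_smul_mem_simplex_of_le hm hh hs
  have hmean := norm_image_sub_le_of_norm_deriv_right_le_segment (a := 0) (b := h) (C := ε)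
    (f := fun s : ℝ => f (m + s • (dirac z - dirac y)) - s * a)
    ((hc.comp (by fun_prop) hmem).sub (by fun_prop))
    (fun s hs => (hf.hasDerivWithinAt_Ici hs.2 (hmem s (Ico_subset_Icc_self hs)) hh).sub
      ((hasDerivAt_id s).mul_const a).hasDerivWithinAt)
    (fun s hs => by simpa using hD s (Ico_subset_Icc_self hs)) h ⟨h0, le_rfl⟩
  simpa [sub_right_comm] using hmean

theorem abs_sub_sub_mul_le_of_lipschitz (hf : IsSimplexDeriv f D)
    (hc : ContinuousOn f (simplex d)) (hD : ∀ y, LipschitzOnWith C (D · y) (simplex d))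
    (hm : m ∈ simplex d) {y z : Fin d} {h : ℝ} (h0 : 0 ≤ h)
    (hh : m + h • (dirac z - dirac y) ∈ simplex d) :
    |f (m + h • (dirac z - dirac y)) - f m - h * D m y z| ≤ 2 * C * h ^ 2 := by
  have hvar : ∀ s ∈ Icc 0 h,
      |D (m + s • (dirac z - dirac y)) y z - D m y z| ≤ 2 * C * h := fun s hs =>
    calc |D (m + s • (dirac z - dirac y)) y z - D m y z|
        ≤ ‖D (m + s • (dirac z - dirac y)) y - D m y‖ := PiLp.norm_apply_le (_ - _ : Vec d) z
      _ ≤ 2 * C * s :=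
        norm_add_smul_dirac_sub_sub_le (hD y) hs.1 hm (add_smul_mem_simplex_of_le hm hh hs)
      _ ≤ 2 * C * h := by gcongr; exact hs.2
  exact (hf.abs_sub_sub_mul_le hc hm h0 hh hvar).trans_eq (by ring)

theorem abs_deriv_le (hf : IsSimplexDeriv f D) (hc : ContinuousOn f (simplex d))
    (hD : ∀ y, LipschitzOnWith C (D · y) (simplex d)) {B : ℝ}
    (hB : ∀ m ∈ simplex d, |f m| ≤ B) (hm : m ∈ simplex d) (y z : Fin d) :
    |D m y z| ≤ 2 * B + 4 * C := by
  have hy := dirac_mem_simplex y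
  have hz := dirac_mem_simplex z
  -- The edge from `δ_y` to `δ_z` bounds the derivative at `δ_y`.
  have hedge : |f (dirac z) - f (dirac y) - D (dirac y) y z| ≤ 2 * C := by
    simpa using hf.abs_sub_sub_mul_le_of_lipschitz hc hD hy (y := y) (z := z) zero_le_one
      (by simpa using hz)
  have hvar : |D m y z - D (dirac y) y z| ≤ 2 * C :=
    calc |D m y z - D (dirac y) y z| ≤ ‖D m y - D (dirac y) y‖ :=
          PiLp.norm_apply_le (_ - _ : Vec d) z
      _ ≤ C * ‖m - dirac y‖ := (hD y).norm_sub_le hm hy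
      _ ≤ C * 2 := by gcongr; exact norm_sub_le_two_of_mem_simplex hm hy
      _ = 2 * C := mul_comm _ _
  have hfy := hB _ hy
  have hfz := hB _ hz
  rw [abs_le] at *
  constructor <;> linarith [hedge.1, hedge.2, hvar.1, hvar.2, hfy.1, hfy.2, hfz.1, hfz.2]

theorem lipschitzOnWith (hf : IsSimplexDeriv f D) (hc : ContinuousOn f (simplex d)) {R : ℝ≥0}
    (hR : ∀ m ∈ simplex d, ∀ y z, |D m y z| ≤ R) :
    LipschitzOnWith (NNReal.sqrt d * R) f (simplex d) :=
  lipschitzOnWith_of_abs_move_le fun _ hm y z _ h0 hh => by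
    simpa using hf.abs_sub_sub_mul_le hc hm h0 hh (a := 0) fun s hs => by
      simpa using hR _ (add_smul_mem_simplex_of_le hm hh hs) y z

end IsSimplexDeriv

/-- `f` is of class `C^{1,1}` on the simplex, with derivative `D`; one constant `C` bounds `D` and
the Lipschitz constants of `f` and of `D`. -/
structure IsC11With (C : ℝ≥0) (f : Vec d → ℝ) (D : Vec d → Fin d → Vec d) : Prop where
  isSimplexDeriv : IsSimplexDeriv f D
  lipschitz : LipschitzOnWith C f (simplex d)
  norm_deriv_le : ∀ m ∈ simplex d, ∀ y, ‖D m y‖ ≤ C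
  lipschitz_deriv : ∀ y, LipschitzOnWith C (D · y) (simplex d)

theorem IsC11With.mono {C' : ℝ≥0} (hf : IsC11With C f D) (hC : C ≤ C') : IsC11With C' f D where
  isSimplexDeriv := hf.isSimplexDeriv
  lipschitz := hf.lipschitz.weaken hC
  norm_deriv_le m hm y := (hf.norm_deriv_le m hm y).trans (NNReal.coe_le_coe.2 hC)
  lipschitz_deriv y := (hf.lipschitz_deriv y).weaken hC

theorem IsSimplexDeriv.isC11With (hf : IsSimplexDeriv f D) (hc : ContinuousOn f (simplex d))
    (hD : ∀ y, LipschitzOnWith C (D · y) (simplex d)) {B : ℝ≥0}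
    (hB : ∀ m ∈ simplex d, |f m| ≤ B) :
    IsC11With (NNReal.sqrt d * (2 * B + 4 * C) + C) f D where
  isSimplexDeriv := hf
  lipschitz := by
    refine (hf.lipschitzOnWith hc fun m hm y z => ?_).weaken le_self_add
    exact_mod_cast hf.abs_deriv_le hc hD hB hm y z
  norm_deriv_le m hm y := by
    refine (norm_le_sqrt_mul (by positivity) (hf.abs_deriv_le hc hD hB hm y)).trans ?_
    push_cast
    exact le_add_of_nonneg_right C.2
  lipschitz_deriv y := (hD y).weaken le_add_self

end Derivative

variable {N : ℕ}

section FiniteDifferences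

theorem diffAt_eq_diff (j : Fin N) (g : (Fin N → Fin d) → ℝ) (x : Fin N → Fin d) :
    diffAt j g x = diff (fun z => g (Function.update x j z)) (x j) := by
  simp only [diffAt, diff, Function.update_eq_self]

theorem diff_sub_diff (g h : Fin d → ℝ) (x : Fin d) :
    diff g x - diff h x = diff (fun y => g y - h y) x := by
  ext y
  exact sub_sub_sub_comm _ _ _ _

theorem diffAt_sub_diffAt (j : Fin N) (g h : (Fin N → Fin d) → ℝ) (x : Fin N → Fin d) :
    diffAt j g x - diffAt j h x = diffAt j (fun y => g y - h y) x := by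
  simp only [diffAt_eq_diff, diff_sub_diff]

theorem norm_diff_le {g : Fin d → ℝ} {b : ℝ} (hg : ∀ y, |g y| ≤ b) (x : Fin d) :
    ‖diff g x‖ ≤ √(d : ℝ) * (2 * b) := by
  have hb : 0 ≤ b := (abs_nonneg _).trans (hg x)
  refine norm_le_sqrt_mul (by positivity) fun y => ?_
  calc |g y - g x| ≤ |g y| + |g x| := abs_sub _ _
    _ ≤ 2 * b := by linarith [hg x, hg y]

theorem norm_diffAt_le {g : (Fin N → Fin d) → ℝ} {b : ℝ} (hg : ∀ x, |g x| ≤ b) (j : Fin N)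
    (x : Fin N → Fin d) : ‖diffAt j g x‖ ≤ √(d : ℝ) * (2 * b) := by
  rw [diffAt_eq_diff]
  exact norm_diff_le (fun z => hg _) _

theorem inner_diff_nonpos {a : Vec d} (ha : ∀ y, 0 ≤ a y) {g : Fin d → ℝ} {x : Fin d}
    (hg : ∀ y, g y ≤ g x) : inner ℝ a (diff g x) ≤ 0 :=
  inner_nonpos_of_nonneg_of_nonpos ha fun y => sub_nonpos.2 (hg y)

theorem inner_diff_nonneg {a : Vec d} (ha : ∀ y, 0 ≤ a y) {g : Fin d → ℝ} {x : Fin d}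
    (hg : ∀ y, g x ≤ g y) : 0 ≤ inner ℝ a (diff g x) :=
  inner_nonneg_of_nonneg ha fun y => sub_nonneg.2 (hg y)

theorem inner_diffAt_nonpos {a : Vec d} (ha : ∀ y, 0 ≤ a y) {g : (Fin N → Fin d) → ℝ}
    {x : Fin N → Fin d} (hg : ∀ y, g y ≤ g x) (j : Fin N) : inner ℝ a (diffAt j g x) ≤ 0 :=
  inner_nonpos_of_nonneg_of_nonpos ha fun _ => sub_nonpos.2 (hg _)

theorem inner_diffAt_nonneg {a : Vec d} (ha : ∀ y, 0 ≤ a y) {g : (Fin N → Fin d) → ℝ}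
    {x : Fin N → Fin d} (hg : ∀ y, g x ≤ g y) (j : Fin N) : 0 ≤ inner ℝ a (diffAt j g x) :=
  inner_nonneg_of_nonneg ha fun _ => sub_nonneg.2 (hg _)

end FiniteDifferences

section EmpiricalMeasures

theorem sub_one_pos_of_two_le (hN : 2 ≤ N) : 0 < (N : ℝ) - 1 := by
  rw [sub_pos]
  exact_mod_cast hN

theorem inv_sub_one_le (hN : 2 ≤ N) : ((N : ℝ) - 1)⁻¹ ≤ 2 / N := by
  have h2 : (2 : ℝ) ≤ N := by exact_mod_cast hN
  rw [inv_eq_one_div, div_le_div_iff₀ (by linarith) (by linarith)]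
  linarith

theorem card_erase_univ (i : Fin N) : (((Finset.univ.erase i).card : ℕ) : ℝ) = (N : ℝ) - 1 := by
  rw [Finset.cast_card_erase_of_mem (Finset.mem_univ i), Finset.card_univ, Fintype.card_fin]

theorem smul_sum_dirac_mem_simplex {ι : Type*} {s : Finset ι} (hs : s.Nonempty) (x : ι → Fin d) :
    (s.card : ℝ)⁻¹ • ∑ j ∈ s, dirac (x j) ∈ simplex d := by
  rw [Finset.smul_sum]
  refine convex_simplex.sum_mem (fun _ _ => by positivity) ?_ fun j _ => dirac_mem_simplex (x j)
  rw [Finset.sum_const, nsmul_eq_mul, mul_inv_cancel₀ (Nat.cast_ne_zero.2 hs.card_ne_zero)]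

theorem empirical_mem_simplex [NeZero N] (x : Fin N → Fin d) : empirical x ∈ simplex d := by
  simpa [empirical] using smul_sum_dirac_mem_simplex Finset.univ_nonempty x

theorem empiricalExcept_mem_simplex (hN : 2 ≤ N) (i : Fin N) (x : Fin N → Fin d) :
    empiricalExcept i x ∈ simplex d := by
  have hcard := card_erase_univ i
  rw [empiricalExcept, ← hcard]
  refine smul_sum_dirac_mem_simplex (Finset.card_pos.1 ?_) x
  exact_mod_cast hcard.symm ▸ sub_one_pos_of_two_le hN

theorem empiricalExcept_eq_smul_sub (i : Fin N) (x : Fin N → Fin d) :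
    empiricalExcept i x = ((N : ℝ) - 1)⁻¹ • (∑ j, dirac (x j) - dirac (x i)) := by
  rw [empiricalExcept, ← Finset.add_sum_erase _ _ (Finset.mem_univ i), add_sub_cancel_left]

theorem empiricalExcept_eq_add (i j : Fin N) (x : Fin N → Fin d) :
    empiricalExcept j x = empiricalExcept i x + ((N : ℝ) - 1)⁻¹ • (dirac (x i) - dirac (x j)) := by
  rw [empiricalExcept_eq_smul_sub, empiricalExcept_eq_smul_sub, ← smul_add, sub_add_sub_cancel]

theorem empiricalExcept_update_self (i : Fin N) (x : Fin N → Fin d) (z : Fin d) :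
    empiricalExcept i (Function.update x i z) = empiricalExcept i x := by
  unfold empiricalExcept
  congr 1
  exact Finset.sum_congr rfl fun j hj => by
    rw [Function.update_of_ne (Finset.ne_of_mem_erase hj)]

theorem empiricalExcept_update {i j : Fin N} (hij : i ≠ j) (x : Fin N → Fin d) (z : Fin d) :
    empiricalExcept i (Function.update x j z) =
      empiricalExcept i x + ((N : ℝ) - 1)⁻¹ • (dirac z - dirac (x j)) := by
  rw [empiricalExcept_eq_add j i, empiricalExcept_eq_add j i x, empiricalExcept_update_self,
    Function.update_self, Function.update_of_ne hij, add_assoc, ← smul_add, add_comm (_ - _),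
    sub_add_sub_cancel]

theorem norm_empiricalExcept_sub_empirical_le (hN : 2 ≤ N) (i : Fin N) (x : Fin N → Fin d) :
    ‖empiricalExcept i x - empirical x‖ ≤ 2 / N := by
  have hN1 := sub_one_pos_of_two_le hN
  have hsub : empiricalExcept i x - empirical x =
      (N : ℝ)⁻¹ • (empiricalExcept i x - dirac (x i)) := by
    rw [empiricalExcept_eq_smul_sub, empirical]
    match_scalars <;> field_simp <;> ring
  rw [hsub, norm_smul, Real.norm_of_nonneg (by positivity), div_eq_inv_mul]
  gcongr
  exact norm_sub_le_two_of_mem_simplex (empiricalExcept_mem_simplex hN i x) (dirac_mem_simplex _)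

end EmpiricalMeasures

/-- The value of player `i` predicted at a fixed time by a solution `f` of the Master Equation. -/
noncomputable def playerValue (f : Fin d → Vec d → ℝ) (i : Fin N) (x : Fin N → Fin d) : ℝ :=
  f (x i) (empiricalExcept i x)

section PlayerValue

variable {f : Fin d → Vec d → ℝ} {D : Fin d → Vec d → Fin d → Vec d} {C : ℝ≥0}

theorem diffAt_playerValue_self (f : Fin d → Vec d → ℝ) (i : Fin N) (x : Fin N → Fin d) :
    diffAt i (playerValue f i) x = diff (fun z => f z (empiricalExcept i x)) (x i) := by
  simp only [diffAt_eq_diff, playerValue, empiricalExcept_update_self, Function.update_self]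

theorem norm_diffAt_playerValue_le (hf : ∀ x, LipschitzOnWith C (f x) (simplex d)) (hN : 2 ≤ N)
    {i j : Fin N} (hij : i ≠ j) (x : Fin N → Fin d) :
    ‖diffAt j (playerValue f i) x‖ ≤ √(d : ℝ) * (2 * C * ((N : ℝ) - 1)⁻¹) := by
  have hN1 := sub_one_pos_of_two_le hN
  refine norm_le_sqrt_mul (by positivity) fun z => ?_
  have hz := empiricalExcept_mem_simplex hN i (Function.update x j z)
  simp only [diffAt, playerValue, Function.update_of_ne hij]
  rw [empiricalExcept_update hij] at hz ⊢
  exact norm_add_smul_dirac_sub_sub_le (hf _) (by positivity)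
    (empiricalExcept_mem_simplex hN i x) hz

theorem norm_smul_deriv_sub_diffAt_playerValue_le (hf : ∀ x, IsC11With C (f x) (D x))
    (hN : 2 ≤ N) {i j : Fin N} (hij : i ≠ j) (x : Fin N → Fin d) :
    ‖((N : ℝ) - 1)⁻¹ • D (x i) (empiricalExcept i x) (x j) - diffAt j (playerValue f i) x‖ ≤
      √(d : ℝ) * (2 * C * ((N : ℝ) - 1)⁻¹ ^ 2) := by
  have hN1 := sub_one_pos_of_two_le hN
  refine norm_le_sqrt_mul (by positivity) fun z => ?_
  have hz := empiricalExcept_mem_simplex hN i (Function.update x j z)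
  simp only [diffAt, playerValue, Function.update_of_ne hij, PiLp.sub_apply, PiLp.smul_apply,
    smul_eq_mul]
  rw [empiricalExcept_update hij] at hz ⊢
  rw [abs_sub_comm]
  exact (hf _).isSimplexDeriv.abs_sub_sub_mul_le_of_lipschitz (hf _).lipschitz.continuousOn
    (hf _).lipschitz_deriv (empiricalExcept_mem_simplex hN i x) (by positivity) hz

theorem norm_diff_sub_diffAt_playerValue_le (hf : ∀ x, LipschitzOnWith C (f x) (simplex d))
    (hN : 2 ≤ N) (i j : Fin N) (x : Fin N → Fin d) :
    ‖diff (fun z => f z (empiricalExcept i x)) (x j) - diffAt j (playerValue f j) x‖ ≤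
      √(d : ℝ) * (2 * (2 * C * ((N : ℝ) - 1)⁻¹)) := by
  rw [diffAt_playerValue_self, diff_sub_diff]
  refine norm_diff_le (fun z => ?_) _
  have hi := empiricalExcept_mem_simplex hN i x
  rw [empiricalExcept_eq_add j i] at hi ⊢
  exact norm_add_smul_dirac_sub_sub_le (hf z) (inv_nonneg.2 (sub_one_pos_of_two_le hN).le)
    (empiricalExcept_mem_simplex hN j x) hi

end PlayerValue

theorem sum_mul_empiricalExcept (i : Fin N) (x : Fin N → Fin d) (g : Fin d → ℝ) :
    ∑ y, g y * empiricalExcept i x y =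
      ((N : ℝ) - 1)⁻¹ * ∑ j ∈ Finset.univ.erase i, g (x j) := by
  simp only [empiricalExcept, PiLp.smul_apply, WithLp.ofLp_sum, Finset.sum_apply, smul_eq_mul,
    Finset.mul_sum, dirac_apply]
  rw [Finset.sum_comm]
  exact Finset.sum_congr rfl fun j _ => by simp [mul_comm]

namespace Game

variable {𝓖 : Game d}

section Hamiltonian

theorem isMaximizer_αStar (x : Fin d) (p : Vec d) :
    IsMaximizer 𝓖.κ 𝓖.M (𝓖.L x) p (𝓖.αStar x p) :=
  (𝓖.unique_maximizer x p).choose_spec.1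

theorem αStar_mem (x : Fin d) (p : Vec d) : 𝓖.αStar x p ∈ 𝓖.A :=
  (isMaximizer_αStar x p).1

theorem αStar_nonneg (x : Fin d) (p : Vec d) (y : Fin d) : 0 ≤ 𝓖.αStar x p y :=
  𝓖.κ_pos.le.trans (αStar_mem x p y).1

theorem norm_αStar_le (x : Fin d) (p : Vec d) : ‖𝓖.αStar x p‖ ≤ √(d : ℝ) * 𝓖.M := by
  refine norm_le_sqrt_mul (𝓖.κ_pos.le.trans 𝓖.κ_le_M) fun y => ?_
  rw [abs_of_nonneg (αStar_nonneg x p y)]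
  exact (αStar_mem x p y).2

theorem H_eq (x : Fin d) (p : Vec d) :
    𝓖.H x p = -inner ℝ (𝓖.αStar x p) p - 𝓖.L x (𝓖.αStar x p) := by
  obtain ⟨hA, hm⟩ := isMaximizer_αStar (𝓖 := 𝓖) x p
  exact IsGreatest.csSup_eq ⟨⟨_, hA, rfl⟩, forall_mem_image.2 fun _ hb => hm hb⟩

/-- The hypothesis `H1` with one constant for all the states, which also bounds the optimal
controls. -/
structure LipschitzHamiltonianWith (𝓖 : Game d) (K : ℝ) (C : ℝ≥0) : Prop where
  lipschitz_H : ∀ x, LipschitzOnWith C (𝓖.H x) (Metric.closedBall 0 K)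
  lipschitz_αStar : ∀ x, LipschitzOnWith C (𝓖.αStar x) (Metric.closedBall 0 K)
  norm_αStar_le : ∀ x p, ‖𝓖.αStar x p‖ ≤ C

variable {K : ℝ} {C : ℝ≥0}

theorem LipschitzHamiltonianWith.mono {C' : ℝ≥0} (h : 𝓖.LipschitzHamiltonianWith K C)
    (hC : C ≤ C') : 𝓖.LipschitzHamiltonianWith K C' where
  lipschitz_H x := (h.lipschitz_H x).weaken hC
  lipschitz_αStar x := (h.lipschitz_αStar x).weaken hC
  norm_αStar_le x p := (h.norm_αStar_le x p).trans hC

theorem H1.exists_lipschitzHamiltonianWith (h : 𝓖.H1 K) :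
    ∃ C, 𝓖.LipschitzHamiltonianWith K C := by
  choose C₁ h₁ using fun x => (h x).1
  choose C₂ h₂ using fun x => (h x).2
  obtain ⟨B₁, hB₁⟩ := Finite.exists_le C₁
  obtain ⟨B₂, hB₂⟩ := Finite.exists_le C₂
  refine ⟨B₁ ⊔ B₂ ⊔ Real.toNNReal (√d * 𝓖.M), fun x => (h₁ x).weaken ?_,
    fun x => (h₂ x).weaken ?_, fun x p => ?_⟩
  · exact (hB₁ x).trans (le_sup_left.trans le_sup_left)
  · exact (hB₂ x).trans (le_sup_right.trans le_sup_left)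
  · exact (norm_αStar_le x p).trans <| (Real.le_coe_toNNReal _).trans <|
      NNReal.coe_le_coe.2 le_sup_right

end Hamiltonian

section Drifts

/-- The last term of the left-hand side of the Master Equation, up to its sign: the derivative in
the direction in which the optimal controls move `m`, of a function on the simplex whose derivative
at `m` is `D`, where `g` is the value function at `m`. -/
noncomputable def meanFieldDrift (𝓖 : Game d) (g : Fin d → ℝ) (D : Fin d → Vec d) (m : Vec d) : ℝ :=
  ∑ y, inner ℝ (D y) (𝓖.αStar y (diff g y)) * m y

/-- The generator of the players other than `i` applied to `g`, when they respond optimally to the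
value functions `u`. -/
noncomputable def othersDrift (𝓖 : Game d) (u : Fin N → (Fin N → Fin d) → ℝ) (i : Fin N)
    (g : (Fin N → Fin d) → ℝ) (x : Fin N → Fin d) : ℝ :=
  ∑ j ∈ Finset.univ.erase i, inner ℝ (𝓖.αStar (x j) (diffAt j (u j) x)) (diffAt j g x)

theorem meanFieldDrift_neg (g : Fin d → ℝ) (D : Fin d → Vec d) (m : Vec d) :
    𝓖.meanFieldDrift g (fun y => -D y) m = -𝓖.meanFieldDrift g D m := by
  simp only [meanFieldDrift, inner_neg_left, neg_mul, Finset.sum_neg_distrib]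

theorem meanFieldDrift_nonpos (g : Fin d → ℝ) {f : Vec d → ℝ} {D : Vec d → Fin d → Vec d}
    (hf : IsSimplexDeriv f D) {m : Vec d} (hm : m ∈ simplex d) (hmax : IsMaxOn f (simplex d) m) :
    𝓖.meanFieldDrift g (D m) m ≤ 0 := by
  refine Finset.sum_nonpos fun y _ => ?_
  rcases (hm.1 y).eq_or_lt with hy | hy
  · rw [← hy, mul_zero]
  · rw [real_inner_comm]
    exact mul_nonpos_of_nonpos_of_nonneg
      (inner_nonpos_of_nonneg_of_nonpos (αStar_nonneg y _) (hf.nonpos_of_isMaxOn hm hmax hy)) hy.le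

theorem meanFieldDrift_nonneg (g : Fin d → ℝ) {f : Vec d → ℝ} {D : Vec d → Fin d → Vec d}
    (hf : IsSimplexDeriv f D) {m : Vec d} (hm : m ∈ simplex d) (hmin : IsMinOn f (simplex d) m) :
    0 ≤ 𝓖.meanFieldDrift g (D m) m := by
  rw [← neg_nonpos, ← meanFieldDrift_neg]
  exact meanFieldDrift_nonpos g hf.neg hm hmin.neg

theorem othersDrift_nonpos (u : Fin N → (Fin N → Fin d) → ℝ) (i : Fin N)
    {g : (Fin N → Fin d) → ℝ} {x : Fin N → Fin d} (hg : ∀ y, g y ≤ g x) :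
    𝓖.othersDrift u i g x ≤ 0 :=
  Finset.sum_nonpos fun j _ => inner_diffAt_nonpos (αStar_nonneg _ _) hg j

theorem othersDrift_nonneg (u : Fin N → (Fin N → Fin d) → ℝ) (i : Fin N)
    {g : (Fin N → Fin d) → ℝ} {x : Fin N → Fin d} (hg : ∀ y, g x ≤ g y) :
    0 ≤ 𝓖.othersDrift u i g x :=
  Finset.sum_nonneg fun j _ => inner_diffAt_nonneg (αStar_nonneg _ _) hg j

theorem othersDrift_sub (u : Fin N → (Fin N → Fin d) → ℝ) (i : Fin N)
    (g h : (Fin N → Fin d) → ℝ) (x : Fin N → Fin d) :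
    𝓖.othersDrift u i (fun y => g y - h y) x = 𝓖.othersDrift u i g x - 𝓖.othersDrift u i h x := by
  simp only [othersDrift, ← diffAt_sub_diffAt, inner_sub_right, Finset.sum_sub_distrib]

end Drifts

section APrioriBounds

variable {g c K : ℝ}

theorem LargeRadius.exists_bounds (hK : 𝓖.LargeRadius K) (x₀ : Fin d) :
    ∃ g c : ℝ, 0 ≤ c ∧ (∀ x, ∀ m ∈ simplex d, |𝓖.G x m| ≤ g) ∧
      (∀ x, ∀ a ∈ 𝓖.A, ∀ m ∈ simplex d, |𝓖.L x a| + |𝓖.F x m| ≤ c) ∧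
      √(d : ℝ) * (2 * (g + c * 𝓖.T)) ≤ K := by
  have hT := 𝓖.T_pos
  have hd : 0 < 2 * √(d : ℝ) := by
    have := x₀.pos
    positivity
  have ha₀ : 𝓖.αStar x₀ 0 ∈ 𝓖.A := αStar_mem x₀ 0
  have hne : Nonempty (Fin d × simplex d) := ⟨(x₀, ⟨dirac x₀, dirac_mem_simplex x₀⟩)⟩
  have hsum : ∀ x y z, ∀ a ∈ 𝓖.A, ∀ m ∈ simplex d, ∀ m' ∈ simplex d,
      |𝓖.G x m| + 𝓖.T * (|𝓖.L y a| + |𝓖.F z m'|) ≤ K / (2 * √(d : ℝ)) :=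
    fun x y z a ha m hm m' hm' => (le_div_iff₀' hd).2 (hK x y z a ha m hm m' hm')
  have hbdd : BddAbove (range fun q : Fin d × simplex d => |𝓖.G q.1 q.2|) := by
    refine ⟨K / (2 * √(d : ℝ)), forall_mem_range.2 fun q => ?_⟩
    exact (le_add_of_nonneg_right (by positivity)).trans
      (hsum q.1 x₀ x₀ _ ha₀ q.2 q.2.2 q.2 q.2.2)
  set g : ℝ := ⨆ q : Fin d × simplex d, |𝓖.G q.1 q.2|
  have hLF : ∀ x, ∀ a ∈ 𝓖.A, ∀ m ∈ simplex d,
      |𝓖.L x a| + |𝓖.F x m| ≤ (K / (2 * √(d : ℝ)) - g) / 𝓖.T := fun x a ha m hm => by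
    rw [le_div_iff₀' hT, le_sub_comm]
    exact ciSup_le fun q => le_sub_iff_add_le.2 (hsum _ _ _ a ha _ q.2.2 m hm)
  refine ⟨g, _, le_trans (by positivity) (hLF x₀ _ ha₀ _ (dirac_mem_simplex x₀)),
    fun x m hm => le_ciSup hbdd (x, ⟨m, hm⟩), hLF, le_of_eq ?_⟩
  rw [div_mul_cancel₀ _ hT.ne', add_sub_cancel, ← mul_assoc, mul_comm _ 2,
    mul_div_cancel₀ _ hd.ne']

theorem gronwallBound_zero_sub_le {T t : ℝ} (hc : 0 ≤ c) (ht : 0 ≤ t) :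
    gronwallBound g 0 c (T - t) ≤ g + c * T := by
  simp only [gronwallBound_K0]
  gcongr
  exact sub_le_self _ ht

section MasterEquation

variable {U Ut : ℝ → Fin d → Vec d → ℝ} {D : ℝ → Fin d → Vec d → Fin d → Vec d}

theorem IsClassicalSolution.continuousOn_uncurry (hU : 𝓖.IsClassicalSolution U Ut D) :
    ContinuousOn (fun q : ℝ × Fin d × Vec d => U q.1 q.2.1 q.2.2)
      (Icc 0 𝓖.T ×ˢ univ ×ˢ simplex d) := by
  have hswap : ContinuousOn (fun q : Fin d × ℝ × Vec d => U q.2.1 q.1 q.2.2)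
      (univ ×ˢ Icc 0 𝓖.T ×ˢ simplex d) :=
    continuousOn_prod_of_discrete_left.2 fun x => (hU.cont x).mono fun q hq => hq.2
  exact hswap.comp (f := fun q : ℝ × Fin d × Vec d => (q.2.1, q.1, q.2.2)) (by fun_prop)
    fun q hq => ⟨hq.2.1, hq.1, hq.2.2⟩

theorem IsClassicalSolution.deriv_time_eq (hU : 𝓖.IsClassicalSolution U Ut D) {t : ℝ}
    (ht : t ∈ Icc 0 𝓖.T) (x : Fin d) {m : Vec d} (hm : m ∈ simplex d) :
    Ut t x m = -(𝓖.meanFieldDrift (U t · m) (D t x m) m - 𝓖.H x (diff (U t · m) x) + 𝓖.F x m) := by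
  rw [← hU.equation t ht x m hm, meanFieldDrift]
  ring

theorem IsClassicalSolution.abs_apply_le (hU : 𝓖.IsClassicalSolution U Ut D) (hc : 0 ≤ c)
    (hG : ∀ x, ∀ m ∈ simplex d, |𝓖.G x m| ≤ g)
    (hLF : ∀ x, ∀ a ∈ 𝓖.A, ∀ m ∈ simplex d, |𝓖.L x a| + |𝓖.F x m| ≤ c)
    {t : ℝ} (ht : t ∈ Icc 0 𝓖.T) (x : Fin d) {m : Vec d} (hm : m ∈ simplex d) :
    |U t x m| ≤ g + c * 𝓖.T := by
  have hbound := abs_le_gronwallBound_of_drift (f := fun t q => U t q.1 q.2) (δ := g) (K := 0)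
    (ε := c) (isCompact_univ.prod isCompact_simplex) hU.continuousOn_uncurry
    (β := fun t q => 𝓖.meanFieldDrift (U t · q.2) (D t q.1 q.2) q.2 +
      inner ℝ (𝓖.αStar q.1 (diff (U t · q.2) q.1)) (diff (U t · q.2) q.1))
    (ℓ := fun t q => 𝓖.L q.1 (𝓖.αStar q.1 (diff (U t · q.2) q.1)) + 𝓖.F q.1 q.2)
    (fun s hs q hq => ?_) (fun s hs q hq hmax => ?_) (fun s hs q hq hmin => ?_)
    (fun s _ q hq ρ _ => ?_) (fun q hq => ?_) t ht (x, m) ⟨mem_univ x, hm⟩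
  · exact hbound.trans (gronwallBound_zero_sub_le hc ht.1)
  · convert hU.deriv_time q.1 q.2 hq.2 s hs using 1
    rw [hU.deriv_time_eq hs q.1 hq.2, H_eq]
    ring
  · exact add_nonpos
      (meanFieldDrift_nonpos _ (hU.deriv_measure s hs q.1) hq.2
        fun m' hm' => hmax (show (q.1, m') ∈ _ from ⟨mem_univ _, hm'⟩))
      (inner_diff_nonpos (αStar_nonneg _ _)
        fun y => hmax (show (y, q.2) ∈ _ from ⟨mem_univ _, hq.2⟩))
  · exact add_nonneg
      (meanFieldDrift_nonneg _ (hU.deriv_measure s hs q.1) hq.2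
        fun m' hm' => hmin (show (q.1, m') ∈ _ from ⟨mem_univ _, hm'⟩))
      (inner_diff_nonneg (αStar_nonneg _ _)
        fun y => hmin (show (y, q.2) ∈ _ from ⟨mem_univ _, hq.2⟩))
  · rw [zero_mul, zero_add]
    exact (abs_add_le _ _).trans (hLF _ _ (αStar_mem _ _) _ hq.2)
  · rw [hU.terminal q.1 q.2 hq.2]
    exact hG q.1 q.2 hq.2

theorem IsClassicalSolution.norm_diff_le (hU : 𝓖.IsClassicalSolution U Ut D)
    (hK : 𝓖.LargeRadius K) {t : ℝ} (ht : t ∈ Icc 0 𝓖.T) (x : Fin d) {m : Vec d}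
    (hm : m ∈ simplex d) : ‖diff (U t · m) x‖ ≤ K := by
  obtain ⟨g, c, hc, hG, hLF, hgK⟩ := hK.exists_bounds x
  exact (FiniteMFG.norm_diff_le (fun y => hU.abs_apply_le hc hG hLF ht y hm) x).trans hgK

theorem IsClassicalSolution.exists_isC11With (hU : 𝓖.IsClassicalSolution U Ut D)
    {C₀ : ℝ≥0} (hD : ∀ t ∈ Icc 0 𝓖.T, ∀ x y, LipschitzOnWith C₀ (D t x · y) (simplex d)) :
    ∃ C : ℝ≥0, ∀ t ∈ Icc 0 𝓖.T, ∀ x, IsC11With C (U t x) (D t x) := by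
  obtain ⟨B, hB⟩ := (isCompact_Icc.prod (isCompact_univ.prod
    isCompact_simplex)).exists_bound_of_continuousOn hU.continuousOn_uncurry
  exact ⟨_, fun t ht x => (hU.deriv_measure t ht x).isC11With
    ((hU.cont x).comp (f := fun m => (t, m)) (by fun_prop) fun _ hm => ⟨ht, hm⟩) (hD t ht x)
    fun m hm => (hB (t, x, m) ⟨ht, mem_univ x, hm⟩).trans (Real.le_coe_toNNReal B)⟩

end MasterEquation

section HJB

variable {v : Fin N → ℝ → (Fin N → Fin d) → ℝ}

theorem IsHJBSolution.hasDerivWithinAt (hv : 𝓖.IsHJBSolution v) (i : Fin N) (x : Fin N → Fin d)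
    {t : ℝ} (ht : t ∈ Icc 0 𝓖.T) :
    HasDerivWithinAt (fun s => v i s x)
      (-(𝓖.othersDrift (v · t) i (v i t) x - 𝓖.H (x i) (diffAt i (v i t) x)
        + 𝓖.F (x i) (empiricalExcept i x))) (Icc 0 𝓖.T) t := by
  obtain ⟨v', hd, h⟩ := hv.1 i x t ht
  convert hd using 1
  rw [← h, othersDrift]
  ring

theorem IsHJBSolution.continuousOn_uncurry (hv : 𝓖.IsHJBSolution v) (i : Fin N) :
    ContinuousOn (fun q : ℝ × (Fin N → Fin d) => v i q.1 q.2) (Icc 0 𝓖.T ×ˢ univ) :=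
  continuousOn_prod_of_discrete_right.2 fun x _ ht =>
    (hv.hasDerivWithinAt i x ht.1).continuousWithinAt.mono fun _ hs => hs.1

theorem IsHJBSolution.abs_apply_le (hv : 𝓖.IsHJBSolution v) (hN : 2 ≤ N) (hc : 0 ≤ c)
    (hG : ∀ x, ∀ m ∈ simplex d, |𝓖.G x m| ≤ g)
    (hLF : ∀ x, ∀ a ∈ 𝓖.A, ∀ m ∈ simplex d, |𝓖.L x a| + |𝓖.F x m| ≤ c)
    {t : ℝ} (ht : t ∈ Icc 0 𝓖.T) (i : Fin N) (x : Fin N → Fin d) :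
    |v i t x| ≤ g + c * 𝓖.T := by
  have hbound := abs_le_gronwallBound_of_drift (f := v i) (δ := g) (K := 0) (ε := c)
    isCompact_univ (hv.continuousOn_uncurry i)
    (β := fun t y => 𝓖.othersDrift (v · t) i (v i t) y +
      inner ℝ (𝓖.αStar (y i) (diffAt i (v i t) y)) (diffAt i (v i t) y))
    (ℓ := fun t y => 𝓖.L (y i) (𝓖.αStar (y i) (diffAt i (v i t) y)) +
      𝓖.F (y i) (empiricalExcept i y))
    (fun s hs y _ => ?_)
    (fun s _ y _ hmax => ?_) (fun s _ y _ hmin => ?_)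
    (fun s _ y _ ρ _ => ?_)
    (fun y _ => ?_) t ht x (mem_univ x)
  · exact hbound.trans (gronwallBound_zero_sub_le hc ht.1)
  · convert hv.hasDerivWithinAt i y hs using 1
    rw [H_eq]
    ring
  · rw [isMaxOn_univ_iff] at hmax
    exact add_nonpos (othersDrift_nonpos _ i hmax) (inner_diffAt_nonpos (αStar_nonneg _ _) hmax i)
  · rw [isMinOn_univ_iff] at hmin
    exact add_nonneg (othersDrift_nonneg _ i hmin) (inner_diffAt_nonneg (αStar_nonneg _ _) hmin i)
  · rw [zero_mul, zero_add]
    exact (abs_add_le _ _).trans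
      (hLF _ _ (αStar_mem _ _) _ (empiricalExcept_mem_simplex hN i y))
  · rw [hv.2 i y]
    exact hG _ _ (empiricalExcept_mem_simplex hN i y)

theorem IsHJBSolution.norm_diffAt_le (hv : 𝓖.IsHJBSolution v) (hN : 2 ≤ N)
    (hK : 𝓖.LargeRadius K) {t : ℝ} (ht : t ∈ Icc 0 𝓖.T) (i j : Fin N) (x : Fin N → Fin d) :
    ‖diffAt j (v i t) x‖ ≤ K := by
  obtain ⟨g, c, hc, hG, hLF, hgK⟩ := hK.exists_bounds (x i)
  exact (FiniteMFG.norm_diffAt_le (fun y => hv.abs_apply_le hN hc hG hLF ht i y) j x).trans hgK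

end HJB

end APrioriBounds

variable {K : ℝ} {C : ℝ≥0}

theorem LipschitzHamiltonianWith.abs_meanFieldDrift_sub_othersDrift_le
    (hH : 𝓖.LipschitzHamiltonianWith K C) {f : Fin d → Vec d → ℝ}
    {D : Fin d → Vec d → Fin d → Vec d} (hf : ∀ x, IsC11With C (f x) (D x))
    (hfK : ∀ x, ∀ m ∈ simplex d, ‖diff (f · m) x‖ ≤ K) (hN : 2 ≤ N) (i : Fin N)
    (x : Fin N → Fin d) :
    |𝓖.meanFieldDrift (f · (empiricalExcept i x)) (D (x i) (empiricalExcept i x))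
        (empiricalExcept i x) - 𝓖.othersDrift (playerValue f) i (playerValue f i) x| ≤
      (2 * √d * C ^ 2 + 8 * √d ^ 2 * C ^ 3) * ((N : ℝ) - 1)⁻¹ := by
  have hm := empiricalExcept_mem_simplex hN i x
  have hN1 := sub_one_pos_of_two_le hN
  have hlip : ∀ y, LipschitzOnWith C (f y) (simplex d) := fun y => (hf y).lipschitz
  have hterm : ∀ j ∈ Finset.univ.erase i,
      |((N : ℝ) - 1)⁻¹ * inner ℝ (D (x i) (empiricalExcept i x) (x j))
          (𝓖.αStar (x j) (diff (f · (empiricalExcept i x)) (x j))) -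
        inner ℝ (𝓖.αStar (x j) (diffAt j (playerValue f j) x)) (diffAt j (playerValue f i) x)| ≤
      (2 * √d * C ^ 2 + 8 * √d ^ 2 * C ^ 3) * ((N : ℝ) - 1)⁻¹ ^ 2 := fun j hj => by
    have hij : i ≠ j := (Finset.ne_of_mem_erase hj).symm
    have hself : ‖diffAt j (playerValue f j) x‖ ≤ K := by
      rw [diffAt_playerValue_self]
      exact hfK _ _ (empiricalExcept_mem_simplex hN j x)
    have hα := (hH.lipschitz_αStar (x j)).norm_sub_le
      (mem_closedBall_zero_iff.2 (hfK (x j) _ hm)) (mem_closedBall_zero_iff.2 hself)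
    rw [← real_inner_smul_left, real_inner_comm (diffAt j (playerValue f i) x)]
    refine (abs_inner_sub_inner_le _ _ _ _).trans ?_
    calc _ ≤ √d * (2 * C * ((N : ℝ) - 1)⁻¹ ^ 2) * C + √d * (2 * C * ((N : ℝ) - 1)⁻¹) *
          (C * (√d * (2 * (2 * C * ((N : ℝ) - 1)⁻¹)))) := by
          gcongr
          · exact norm_smul_deriv_sub_diffAt_playerValue_le hf hN hij x
          · exact hH.norm_αStar_le _ _
          · exact norm_diffAt_playerValue_le hlip hN hij x
          · exact hα.trans (by gcongr; exact norm_diff_sub_diffAt_playerValue_le hlip hN i j x)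
      _ = _ := by ring
  rw [meanFieldDrift, sum_mul_empiricalExcept i x fun y => inner ℝ _ _, othersDrift,
    Finset.mul_sum, ← Finset.sum_sub_distrib]
  refine (Finset.abs_sum_le_sum_abs _ _).trans ((Finset.sum_le_card_nsmul _ _ _ hterm).trans ?_)
  rw [nsmul_eq_mul, card_erase_univ]
  exact le_of_eq (by field_simp)

theorem LipschitzHamiltonianWith.abs_othersDrift_sub_othersDrift_le
    (hH : 𝓖.LipschitzHamiltonianWith K C) {u w : Fin N → (Fin N → Fin d) → ℝ} {ρ : ℝ}
    (hu : ∀ j x, ‖diffAt j (u j) x‖ ≤ K) (hw : ∀ j x, ‖diffAt j (w j) x‖ ≤ K)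
    (hρ : ∀ j x, |u j x - w j x| ≤ ρ) {i : Fin N} {g : (Fin N → Fin d) → ℝ} {b : ℝ}
    (hg : ∀ j ≠ i, ∀ x, ‖diffAt j g x‖ ≤ b) (x : Fin N → Fin d) :
    |𝓖.othersDrift u i g x - 𝓖.othersDrift w i g x| ≤ ((N : ℝ) - 1) * (C * (√d * (2 * ρ)) * b) := by
  rw [← card_erase_univ i, ← nsmul_eq_mul, othersDrift, othersDrift, ← Finset.sum_sub_distrib]
  refine (Finset.abs_sum_le_sum_abs _ _).trans (Finset.sum_le_card_nsmul _ _ _ fun j hj => ?_)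
  have hlip := (hH.lipschitz_αStar (x j)).norm_sub_le (mem_closedBall_zero_iff.2 (hu j x))
    (mem_closedBall_zero_iff.2 (hw j x))
  rw [diffAt_sub_diffAt] at hlip
  have hα := hlip.trans (mul_le_mul_of_nonneg_left (norm_diffAt_le (hρ j) j x) C.2)
  rw [← inner_sub_left]
  exact (abs_real_inner_le_norm _ _).trans (mul_le_mul hα (hg j (Finset.ne_of_mem_erase hj) x)
    (norm_nonneg _) ((norm_nonneg _).trans hα))

theorem LipschitzHamiltonianWith.abs_H_sub_H_le (hH : 𝓖.LipschitzHamiltonianWith K C)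
    {g h : (Fin N → Fin d) → ℝ} {ρ : ℝ} {j : Fin N} {x : Fin N → Fin d}
    (hg : ‖diffAt j g x‖ ≤ K) (hh : ‖diffAt j h x‖ ≤ K) (hρ : ∀ x, |g x - h x| ≤ ρ) :
    |𝓖.H (x j) (diffAt j g x) - 𝓖.H (x j) (diffAt j h x)| ≤ C * (√d * (2 * ρ)) := by
  have hlip := (hH.lipschitz_H (x j)).norm_sub_le (mem_closedBall_zero_iff.2 hg)
    (mem_closedBall_zero_iff.2 hh)
  rw [diffAt_sub_diffAt] at hlip
  exact hlip.trans (by gcongr; exact norm_diffAt_le hρ j x)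

section Comparison

variable {U Ut : ℝ → Fin d → Vec d → ℝ} {D : ℝ → Fin d → Vec d → Fin d → Vec d}
  {v : Fin N → ℝ → (Fin N → Fin d) → ℝ}

theorem IsClassicalSolution.norm_diffAt_playerValue_self_le (hU : 𝓖.IsClassicalSolution U Ut D)
    (hK : 𝓖.LargeRadius K) (hN : 2 ≤ N) {t : ℝ} (ht : t ∈ Icc 0 𝓖.T) (i : Fin N)
    (x : Fin N → Fin d) : ‖diffAt i (playerValue (U t) i) x‖ ≤ K := by
  rw [diffAt_playerValue_self]
  exact hU.norm_diff_le hK ht _ (empiricalExcept_mem_simplex hN i x)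

theorem IsHJBSolution.hasDerivWithinAt_sub_playerValue (hv : 𝓖.IsHJBSolution v)
    (hU : 𝓖.IsClassicalSolution U Ut D) (hN : 2 ≤ N) (i : Fin N) (x : Fin N → Fin d) {t : ℝ}
    (ht : t ∈ Icc 0 𝓖.T) :
    HasDerivWithinAt (fun s => v i s x - playerValue (U s) i x)
      (-(𝓖.othersDrift (v · t) i (fun y => v i t y - playerValue (U t) i y) x +
        (𝓖.othersDrift (v · t) i (playerValue (U t) i) x -
          𝓖.meanFieldDrift (U t · (empiricalExcept i x)) (D t (x i) (empiricalExcept i x))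
            (empiricalExcept i x) -
          (𝓖.H (x i) (diffAt i (v i t) x) - 𝓖.H (x i) (diffAt i (playerValue (U t) i) x)))))
      (Icc 0 𝓖.T) t := by
  have hm := empiricalExcept_mem_simplex hN i x
  refine ((hv.hasDerivWithinAt i x ht).sub (hU.deriv_time (x i) _ hm t ht)).congr_deriv ?_
  rw [hU.deriv_time_eq ht _ hm, othersDrift_sub, diffAt_playerValue_self]
  ring

theorem IsHJBSolution.continuousOn_sub_playerValue (hv : 𝓖.IsHJBSolution v)
    (hU : 𝓖.IsClassicalSolution U Ut D) (hN : 2 ≤ N) :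
    ContinuousOn (fun q : ℝ × Fin N × (Fin N → Fin d) =>
      v q.2.1 q.1 q.2.2 - playerValue (U q.1) q.2.1 q.2.2) (Icc 0 𝓖.T ×ˢ univ) :=
  continuousOn_prod_of_discrete_right.2 fun q _ ht =>
    (hv.hasDerivWithinAt_sub_playerValue hU hN q.1 q.2 ht.1).continuousWithinAt.mono
      fun _ hs => hs.1

theorem IsHJBSolution.abs_sub_playerValue_le (hv : 𝓖.IsHJBSolution v)
    (hU : 𝓖.IsClassicalSolution U Ut D) (hf : ∀ t ∈ Icc 0 𝓖.T, ∀ x, IsC11With C (U t x) (D t x))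
    (hH : 𝓖.LipschitzHamiltonianWith K C) (hK : 𝓖.LargeRadius K) (hN : 2 ≤ N) {t : ℝ}
    (ht : t ∈ Icc 0 𝓖.T) (i : Fin N) (x : Fin N → Fin d) :
    |v i t x - playerValue (U t) i x| ≤ gronwallBound 0 (4 * √d ^ 2 * C ^ 2 + 2 * √d * C)
      ((2 * √d * C ^ 2 + 8 * √d ^ 2 * C ^ 3) * ((N : ℝ) - 1)⁻¹) (𝓖.T - t) := by
  refine abs_le_gronwallBound_of_drift
    (f := fun t (q : Fin N × (Fin N → Fin d)) => v q.1 t q.2 - playerValue (U t) q.1 q.2)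
    isCompact_univ (hv.continuousOn_sub_playerValue hU hN)
    (fun s hs q _ => hv.hasDerivWithinAt_sub_playerValue hU hN q.1 q.2 hs)
    (fun s _ q _ hmax => othersDrift_nonpos _ _ fun y => hmax (mem_univ (q.1, y)))
    (fun s _ q _ hmin => othersDrift_nonneg _ _ fun y => hmin (mem_univ (q.1, y)))
    (fun s hs q _ ρ hρ => ?_) (fun q _ => ?_) t ht (i, x) (mem_univ _)
  · have hρ' : ∀ j y, |v j s y - playerValue (U s) j y| ≤ ρ := fun j y => hρ (j, y) (mem_univ _)
    have hvK := fun j => hv.norm_diffAt_le hN hK hs j j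
    have huK := fun j => hU.norm_diffAt_playerValue_self_le hK hN hs j
    have hconsistency := hH.abs_meanFieldDrift_sub_othersDrift_le (hf s hs)
      (fun z m hm => hU.norm_diff_le hK hs z hm) hN q.1 q.2
    have hcontrols := hH.abs_othersDrift_sub_othersDrift_le (u := (v · s))
      (w := playerValue (U s)) hvK huK hρ' (i := q.1) (fun j hj => norm_diffAt_playerValue_le
        (fun z => (hf s hs z).lipschitz) hN hj.symm) q.2
    have hHam := hH.abs_H_sub_H_le (hvK q.1 q.2) (huK q.1 q.2) (hρ' q.1)
    have hN1 := (sub_one_pos_of_two_le hN).ne'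
    calc _ ≤ ((N : ℝ) - 1) * (C * (√d * (2 * ρ)) * (√d * (2 * C * ((N : ℝ) - 1)⁻¹))) +
          (2 * √d * C ^ 2 + 8 * √d ^ 2 * C ^ 3) * ((N : ℝ) - 1)⁻¹ + C * (√d * (2 * ρ)) := by
          rw [abs_le] at hconsistency hcontrols hHam ⊢
          constructor <;> linarith [hconsistency.1, hconsistency.2, hcontrols.1, hcontrols.2]
      _ = _ := by field_simp; ring
  · simp only [playerValue]
    rw [hv.2, hU.terminal _ _ (empiricalExcept_mem_simplex hN _ _), sub_self, abs_zero]

theorem gronwallBound_zero_mul (K a ε x : ℝ) :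
    gronwallBound 0 K (ε * a) x = gronwallBound 0 K ε x * a := by
  unfold gronwallBound
  split_ifs <;> ring

theorem IsClassicalSolution.exists_abs_sub_playerValue_le (hU : 𝓖.IsClassicalSolution U Ut D)
    (hf : ∀ t ∈ Icc 0 𝓖.T, ∀ x, IsC11With C (U t x) (D t x))
    (hH : 𝓖.LipschitzHamiltonianWith K C) (hK : 𝓖.LargeRadius K) :
    ∃ C' : ℝ, 0 ≤ C' ∧ ∀ N, 2 ≤ N → ∀ v : Fin N → ℝ → (Fin N → Fin d) → ℝ, 𝓖.IsHJBSolution v →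
      ∀ t ∈ Icc 0 𝓖.T, ∀ i x, |v i t x - playerValue (U t) i x| ≤ C' / N := by
  set E := gronwallBound 0 (4 * √d ^ 2 * C ^ 2 + 2 * √d * C)
    (2 * √d * C ^ 2 + 8 * √d ^ 2 * C ^ 3)
  have hE : Monotone E := gronwallBound_mono le_rfl (by positivity) (by positivity)
  have hE_nonneg : 0 ≤ E 𝓖.T := (gronwallBound_x0 _ _ _).symm.le.trans (hE 𝓖.T_pos.le)
  refine ⟨2 * E 𝓖.T, by positivity, fun N hN v hv t ht i x => ?_⟩
  calc |v i t x - playerValue (U t) i x| ≤ E (𝓖.T - t) * ((N : ℝ) - 1)⁻¹ := by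
        rw [← gronwallBound_zero_mul]
        exact hv.abs_sub_playerValue_le hU hf hH hK hN ht i x
    _ ≤ E 𝓖.T * (2 / N) := by
        gcongr
        · exact inv_nonneg.2 (sub_one_pos_of_two_le hN).le
        · exact hE (sub_le_self _ ht.1)
        · exact inv_sub_one_le hN
    _ = 2 * E 𝓖.T / N := by ring

end Comparison

end Game

section ProductWeight

variable {ι α : Type*} [Fintype ι]

/-- The mass of `y` under the product of the laws `p k`, so that expectations under the product law
are finite sums. -/
def productWeight (p : ι → α → ℝ) (y : ι → α) : ℝ := ∏ k, p k (y k)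

variable {p : ι → α → ℝ}

theorem productWeight_nonneg (hp₀ : ∀ j a, 0 ≤ p j a) (y : ι → α) : 0 ≤ productWeight p y :=
  Finset.prod_nonneg fun j _ => hp₀ j (y j)

variable [DecidableEq ι]

theorem mul_productWeight_update (p : ι → α → ℝ) (y : ι → α) (j : ι) (a : α) :
    p j (y j) * productWeight p (Function.update y j a) = p j a * productWeight p y := by
  simp only [productWeight, Function.apply_update (fun k => p k),
    Finset.prod_update_of_mem (Finset.mem_univ j),
    Finset.prod_eq_mul_prod_sdiff_singleton_of_mem (Finset.mem_univ j) fun k => p k (y k)]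
  ring

variable [Fintype α]

theorem sum_productWeight (hp : ∀ j, ∑ a, p j a = 1) : ∑ y, productWeight p y = 1 := by
  simp only [productWeight]
  rw [← Fintype.piFinset_univ, ← Finset.prod_univ_sum, Finset.prod_eq_one fun j _ => hp j]

theorem sum_productWeight_mul_eq_sum_update {j : ι} (hp : ∑ a, p j a = 1) (φ : (ι → α) → ℝ) :
    ∑ y, productWeight p y * φ y =
      ∑ y, productWeight p y * ∑ a, p j a * φ (Function.update y j a) := by
  -- Resample the `j`-th coordinate: exchanging it with an independent copy preserves the law.
  have hswap : Function.Involutive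
      fun q : (ι → α) × α => (Function.update q.1 j q.2, q.1 j) := fun q => by simp
  calc ∑ y, productWeight p y * φ y
      = ∑ q : (ι → α) × α, p j q.2 * (productWeight p q.1 * φ q.1) := by
        simp only [Fintype.sum_prod_type, ← Finset.sum_mul, hp, one_mul]
    _ = ∑ q : (ι → α) × α, p j (q.1 j) *
          (productWeight p (Function.update q.1 j q.2) * φ (Function.update q.1 j q.2)) :=
        (Equiv.sum_comp hswap.toPerm fun q => p j q.2 * (productWeight p q.1 * φ q.1)).symm
    _ = _ := by
        simp only [Fintype.sum_prod_type, Finset.mul_sum]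
        refine Finset.sum_congr rfl fun y _ => Finset.sum_congr rfl fun a _ => ?_
        rw [← mul_assoc, mul_productWeight_update, mul_comm (p j a), mul_assoc]

variable {E : Type*} [SeminormedAddCommGroup E] [InnerProductSpace ℝ E] {g : ι → α → E} {b : ℝ}

theorem sum_productWeight_mul_inner_eq_zero {j l : ι} (hp : ∑ a, p j a = 1) (hjl : j ≠ l)
    (hg : ∑ a, p j a • g j a = 0) :
    ∑ y, productWeight p y * inner ℝ (g j (y j)) (g l (y l)) = 0 := by
  rw [sum_productWeight_mul_eq_sum_update hp]
  simp only [Function.update_self, Function.update_of_ne hjl.symm, ← real_inner_smul_left,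
    ← sum_inner, hg, inner_zero_left, mul_zero, Finset.sum_const_zero]

theorem sum_productWeight_mul_norm_sum_sq_le (hp₀ : ∀ j a, 0 ≤ p j a) (hp : ∀ j, ∑ a, p j a = 1)
    {s : Finset ι} (hg : ∀ j ∈ s, ∑ a, p j a • g j a = 0) (hb : ∀ j a, ‖g j a‖ ≤ b) :
    ∑ y, productWeight p y * ‖∑ j ∈ s, g j (y j)‖ ^ 2 ≤ s.card * b ^ 2 := by
  have hdiag : ∀ j ∈ s,
      ∑ l ∈ s, ∑ y, productWeight p y * inner ℝ (g j (y j)) (g l (y l)) ≤ b ^ 2 := fun j hj => by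
    rw [Finset.sum_eq_single_of_mem j hj fun l _ hl =>
      sum_productWeight_mul_inner_eq_zero (hp j) hl.symm (hg j hj)]
    calc ∑ y, productWeight p y * inner ℝ (g j (y j)) (g j (y j))
        ≤ ∑ y, productWeight p y * b ^ 2 := by
          gcongr with y
          · exact productWeight_nonneg hp₀ y
          · rw [real_inner_self_eq_norm_sq]
            exact pow_le_pow_left₀ (norm_nonneg _) (hb j _) 2
      _ = b ^ 2 := by rw [← Finset.sum_mul, sum_productWeight hp, one_mul]
  calc ∑ y, productWeight p y * ‖∑ j ∈ s, g j (y j)‖ ^ 2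
      = ∑ j ∈ s, ∑ l ∈ s, ∑ y, productWeight p y * inner ℝ (g j (y j)) (g l (y l)) := by
        simp only [← real_inner_self_eq_norm_sq, sum_inner, inner_sum, Finset.mul_sum]
        rw [Finset.sum_comm]
        exact (Finset.sum_congr rfl fun _ _ => Finset.sum_comm).trans Finset.sum_comm
    _ ≤ s.card * b ^ 2 := (Finset.sum_le_card_nsmul _ _ _ hdiag).trans_eq (nsmul_eq_mul _ _)

theorem sum_productWeight_mul_norm_sum_le (hp₀ : ∀ j a, 0 ≤ p j a) (hp : ∀ j, ∑ a, p j a = 1)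
    {s : Finset ι} (hg : ∀ j ∈ s, ∑ a, p j a • g j a = 0) (hb : ∀ j a, ‖g j a‖ ≤ b) :
    ∑ y, productWeight p y * ‖∑ j ∈ s, g j (y j)‖ ≤ √(s.card * b ^ 2) :=
  Real.le_sqrt_of_sq_le <| (Real.pow_arith_mean_le_arith_mean_pow Finset.univ _ _
    (fun y _ => productWeight_nonneg hp₀ y) (sum_productWeight hp)
    (fun _ _ => norm_nonneg _) 2).trans (sum_productWeight_mul_norm_sum_sq_le hp₀ hp hg hb)

end ProductWeight

/-- The laws of the states of the players when player `i` is at `x` and the others are distributed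
according to `m₀`: the average defining `w^{N,i}` is the expectation under their product. -/
noncomputable def playerLaw (i : Fin N) (x : Fin d) (m₀ : Vec d) : Fin N → Fin d → ℝ :=
  Function.update (fun _ => m₀) i (dirac x)

section Averaging

variable {m₀ : Vec d} {x : Fin d} {i : Fin N}

theorem playerLaw_nonneg (hm : m₀ ∈ simplex d) (j : Fin N) (a : Fin d) :
    0 ≤ playerLaw i x m₀ j a := by
  rcases eq_or_ne j i with rfl | hj
  · simpa [playerLaw] using (dirac_mem_simplex x).1 a
  · simpa [playerLaw, hj] using hm.1 a

theorem sum_playerLaw (hm : m₀ ∈ simplex d) (j : Fin N) : ∑ a, playerLaw i x m₀ j a = 1 := by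
  rcases eq_or_ne j i with rfl | hj
  · simpa [playerLaw] using (dirac_mem_simplex x).2
  · simpa [playerLaw, hj] using hm.2

theorem productWeight_playerLaw (y : Fin N → Fin d) : productWeight (playerLaw i x m₀) y =
    if y i = x then ∏ j ∈ Finset.univ.erase i, m₀ (y j) else 0 := by
  have hothers : ∏ j ∈ Finset.univ.erase i, playerLaw i x m₀ j (y j) =
      ∏ j ∈ Finset.univ.erase i, m₀ (y j) := Finset.prod_congr rfl fun j hj => by
    rw [playerLaw, Function.update_of_ne (Finset.ne_of_mem_erase hj)]
  rw [productWeight, ← Finset.mul_prod_erase _ _ (Finset.mem_univ i), hothers, playerLaw,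
    Function.update_self, dirac_apply, ite_mul, one_mul, zero_mul]

theorem averaged_eq_sum_productWeight (v : Fin N → ℝ → (Fin N → Fin d) → ℝ) (t : ℝ) :
    averaged v i t x m₀ = ∑ y, productWeight (playerLaw i x m₀) y * v i t y := by
  rw [averaged, Finset.sum_filter]
  refine Finset.sum_congr rfl fun y _ => ?_
  rw [productWeight_playerLaw, ite_mul, zero_mul, mul_comm]

theorem sum_smul_dirac_sub_eq_zero (hm : m₀ ∈ simplex d) : ∑ a, m₀ a • (dirac a - m₀) = 0 := by
  simp only [smul_sub, Finset.sum_sub_distrib, ← Finset.sum_smul, hm.2, one_smul]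
  ext k
  simp [dirac_apply]

theorem sum_productWeight_mul_norm_empiricalExcept_sub_le (hm : m₀ ∈ simplex d) (hN : 2 ≤ N) :
    ∑ y, productWeight (playerLaw i x m₀) y * ‖empiricalExcept i y - m₀‖ ≤ 4 / √(N : ℝ) := by
  have hN1 := sub_one_pos_of_two_le hN
  have hcentred : ∀ y : Fin N → Fin d, ‖empiricalExcept i y - m₀‖ =
      ((N : ℝ) - 1)⁻¹ * ‖∑ j ∈ Finset.univ.erase i, (dirac (y j) - m₀)‖ := fun y => by
    rw [← norm_smul_of_nonneg (inv_nonneg.2 hN1.le), Finset.sum_sub_distrib, Finset.sum_const,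
      ← Nat.cast_smul_eq_nsmul ℝ, card_erase_univ, smul_sub, inv_smul_smul₀ hN1.ne',
      empiricalExcept]
  have hmoment := sum_productWeight_mul_norm_sum_le (p := playerLaw i x m₀)
    (g := fun _ a => dirac a - m₀) (s := Finset.univ.erase i) (playerLaw_nonneg hm)
    (sum_playerLaw hm)
    (fun j hj => by
      simpa only [playerLaw, Function.update_of_ne (Finset.ne_of_mem_erase hj)] using
        sum_smul_dirac_sub_eq_zero hm)
    fun _ a => norm_sub_le_two_of_mem_simplex (dirac_mem_simplex a) hm
  simp only [hcentred, mul_left_comm _ ((N : ℝ) - 1)⁻¹]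
  rw [← Finset.mul_sum]
  calc _ ≤ ((N : ℝ) - 1)⁻¹ * √(((N : ℝ) - 1) * 2 ^ 2) := by
        rw [card_erase_univ] at hmoment
        gcongr
    _ = 2 * √((N : ℝ) - 1)⁻¹ := by
        rw [Real.sqrt_mul hN1.le, Real.sqrt_sq two_pos.le, ← mul_assoc, inv_mul_eq_div,
          Real.sqrt_div_self', Real.sqrt_inv, one_div, mul_comm]
    _ ≤ 2 * √(2 ^ 2 / N) := by
        gcongr
        exact (inv_sub_one_le hN).trans (by gcongr; norm_num)
    _ = 4 / √(N : ℝ) := by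
        rw [Real.sqrt_div (by positivity), Real.sqrt_sq two_pos.le]
        ring

theorem abs_averaged_sub_le {v : Fin N → ℝ → (Fin N → Fin d) → ℝ} {t : ℝ}
    {f : Fin d → Vec d → ℝ} {C : ℝ≥0} {ε : ℝ} (hf : LipschitzOnWith C (f x) (simplex d))
    (hv : ∀ y, |v i t y - playerValue f i y| ≤ ε) (hm : m₀ ∈ simplex d) (hN : 2 ≤ N) :
    |averaged v i t x m₀ - f x m₀| ≤ ε + C * (4 / √(N : ℝ)) := by
  set W := productWeight (playerLaw i x m₀)
  have hW : ∑ y, W y = 1 := sum_productWeight (sum_playerLaw hm)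
  have hpointwise : ∀ y, |W y * (v i t y - f x m₀)| ≤
      W y * ε + C * (W y * ‖empiricalExcept i y - m₀‖) := fun y => by
    by_cases hy : y i = x
    · rw [abs_mul, abs_of_nonneg (productWeight_nonneg (playerLaw_nonneg hm) y),
        mul_left_comm, ← mul_add]
      refine mul_le_mul_of_nonneg_left ?_ (productWeight_nonneg (playerLaw_nonneg hm) y)
      refine (abs_sub_le _ (playerValue f i y) _).trans (add_le_add (hv y) ?_)
      rw [playerValue, hy]
      exact hf.norm_sub_le (empiricalExcept_mem_simplex hN i y) hm
    · simp [W, productWeight_playerLaw, hy]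
  calc |averaged v i t x m₀ - f x m₀| = |∑ y, W y * (v i t y - f x m₀)| := by
        simp only [averaged_eq_sum_productWeight, mul_sub, Finset.sum_sub_distrib,
          ← Finset.sum_mul, W, hW, one_mul]
    _ ≤ ∑ y, (W y * ε + C * (W y * ‖empiricalExcept i y - m₀‖)) :=
        (Finset.abs_sum_le_sum_abs _ _).trans (Finset.sum_le_sum fun y _ => hpointwise y)
    _ = ε + C * ∑ y, W y * ‖empiricalExcept i y - m₀‖ := by
        rw [Finset.sum_add_distrib, ← Finset.sum_mul, hW, one_mul, ← Finset.mul_sum]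
    _ ≤ ε + C * (4 / √(N : ℝ)) := by
        gcongr
        exact sum_productWeight_mul_norm_empiricalExcept_sub_le hm hN

theorem normL1_le (hm : m₀ ∈ simplex d) {g : Fin d → ℝ} {b : ℝ} (hg : ∀ x, |g x| ≤ b) :
    normL1 m₀ g ≤ b :=
  calc normL1 m₀ g ≤ ∑ x, b * m₀ x :=
        Finset.sum_le_sum fun x _ => mul_le_mul_of_nonneg_right (hg x) (hm.1 x)
    _ = b := by rw [← Finset.mul_sum, hm.2, mul_one]

end Averaging

theorem abs_sub_empirical_le {f : Fin d → Vec d → ℝ} {C : ℝ≥0} {r ε : ℝ} {i : Fin N}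
    {x : Fin N → Fin d} (hf : LipschitzOnWith C (f (x i)) (simplex d))
    (hr : |r - playerValue f i x| ≤ ε) (hN : 2 ≤ N) :
    |r - f (x i) (empirical x)| ≤ ε + C * (2 / N) := by
  have : NeZero N := ⟨by omega⟩
  refine (abs_sub_le _ (playerValue f i x) _).trans (add_le_add hr ?_)
  refine (hf.norm_sub_le (empiricalExcept_mem_simplex hN i x) (empirical_mem_simplex x)).trans ?_
  gcongr
  exact norm_empiricalExcept_sub_empirical_le hN i x

theorem average_abs_sub_empirical_le {u : Fin N → ℝ} {f : Fin d → Vec d → ℝ} {C : ℝ≥0}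
    {ε : ℝ} {x : Fin N → Fin d} (hf : ∀ x, LipschitzOnWith C (f x) (simplex d))
    (hu : ∀ i, |u i - playerValue f i x| ≤ ε) (hN : 2 ≤ N) :
    1 / (N : ℝ) * ∑ i, |u i - f (x i) (empirical x)| ≤ ε + C * (2 / N) := by
  have hN0 : (0 : ℝ) < N := by exact_mod_cast zero_lt_two.trans_le hN
  rw [one_div_mul_eq_div, div_le_iff₀' hN0]
  simpa only [Finset.card_univ, Fintype.card_fin, nsmul_eq_mul] using
    Finset.sum_le_card_nsmul Finset.univ _ _ fun i _ => abs_sub_empirical_le (hf _) (hu i) hN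

end FiniteMFG

theorem theorem3p1 {d : ℕ} (𝓖 : FiniteMFG.Game d) (K : ℝ) (hK : 𝓖.LargeRadius K) (hH1 : 𝓖.H1 K)
    (U : ℝ → Fin d → FiniteMFG.Vec d → ℝ) (hU : 𝓖.IsRegularSolution U) :
    ∃ C : ℝ, ∀ N : ℕ, 2 ≤ N → ∀ v : Fin N → ℝ → (Fin N → Fin d) → ℝ, 𝓖.IsHJBSolution v →
      ∀ t₀ ∈ Set.Icc 0 𝓖.T,
        (∀ x : Fin N → Fin d,
          1 / (N : ℝ) * ∑ i, |v i t₀ x - U t₀ (x i) (FiniteMFG.empirical x)| ≤ C / N) ∧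
        (∀ m₀ ∈ FiniteMFG.simplex d, ∀ i : Fin N,
          FiniteMFG.normL1 m₀ (fun x => FiniteMFG.averaged v i t₀ x m₀ - U t₀ x m₀) ≤
            C / √(N : ℝ)) := by
  obtain ⟨Ut, D, hclass, C₀, hD⟩ := hU
  obtain ⟨C₁, hC₁⟩ := hclass.exists_isC11With hD
  obtain ⟨C₂, hC₂⟩ := hH1.exists_lipschitzHamiltonianWith
  set C := C₁ ⊔ C₂
  have hC11 := fun t ht x => (hC₁ t ht x).mono (le_sup_left : C₁ ≤ C)
  obtain ⟨E, hE₀, hE⟩ :=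
    hclass.exists_abs_sub_playerValue_le hC11 (hC₂.mono (le_sup_right : C₂ ≤ C)) hK
  refine ⟨E + C * 4, fun N hN v hv t₀ ht₀ => ⟨fun x => ?_, fun m₀ hm₀ i => ?_⟩⟩
  · calc _ ≤ E / N + C * (2 / N) := FiniteMFG.average_abs_sub_empirical_le
          (fun x => (hC11 t₀ ht₀ x).lipschitz) (fun i => hE N hN v hv t₀ ht₀ i x) hN
      _ = (E + C * 2) / N := by ring
      _ ≤ (E + C * 4) / N := by gcongr; norm_num
  · calc _ ≤ E / N + C * (4 / √(N : ℝ)) := FiniteMFG.normL1_le hm₀ fun x =>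
          FiniteMFG.abs_averaged_sub_le (hC11 t₀ ht₀ x).lipschitz (hE N hN v hv t₀ ht₀ i) hm₀ hN
      _ ≤ E / √(N : ℝ) + C * (4 / √(N : ℝ)) := by
          gcongr
          exact Real.sqrt_le_iff.2 ⟨N.cast_nonneg, by exact_mod_cast Nat.le_self_pow two_ne_zero N⟩
      _ = (E + C * 4) / √(N : ℝ) := by ring
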